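/- Let $M$ and $N$ be manifolds of class $C^2$ without boundary (Hausdorff, with countable basis), of dimensions $m$ and $n$. Measurability and negligible sets in $M$ are understood with respect to Lebesgue measure in local charts. A function $g\colon M\to\mathbb{R}$ is weakly differentiable if in local charts it is of class $W^{1,1}_{\mathrm{loc}}$; its weak derivative is denoted by $Tg$. Let $P$ be a manifold of class $C^1$. A map $w\colon M\to P$ is *colocally weakly differentiable* if it is measurable and if $f\circ w$ is weakly differentiable for every $f\in C^1_c(P,\mathbb{R})$. A *colocal weak derivative* of such a map $w$ is a measurable bundle morphism $Tw\colon TM\to TP$ that covers $w$ such that, for every $f\in C^1_c(P,\mathbb{R})$, $T(f\circ w)=Tf\circ Tw$ almost everywhere in $M$. Let $T^*M\otimes TN$ be the vector bundle over $M\times N$ with fibre $T_x^*M\otimes T_yN=\mathcal{L}(T_xM,T_yN)$ over $(x,y)$; it is a manifold of class $C^1$. If $u\colon M\to N$ has a colocal weak derivative $Tu$, then $Tu$ is viewed as a map $M\to T^*M\otimes TN$, $x\mapsto Tu(x)\in\mathcal{L}(T_xM,T_{u(x)}N)$. The map $u$ is *twice colocally weakly differentiable* if it is colocally weakly differentiable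 and if its colocal weak derivative $Tu\colon M\to T^*M\otimes TN$ is colocally weakly differentiable. A *connection* on a vector bundle $\pi\colon E\to B$ is a continuous map $K\colon TE\to E$ that is a bundle morphism from $TE\to E$ to $E\to B$ covering $\pi$, a bundle morphism from $T\pi\colon TE\to TB$ to $E\to B$ covering $TB\to B$, and that satisfies $K(\operatorname{Vert}_e(\nu))=\nu$ for all $e,\nu$ in the same fibre, where $\operatorname{Vert}_e(\nu)=\frac{d}{dt}(e+t\nu)\big|_{t=0}\in T_eE$ is the vertical lift. For $e\in E$ and $w\in T_{\pi(e)}B$, the horizontal lift $\operatorname{Hor}_{K,e}(w)$ is the unique $\xi\in T_eE$ with $T\pi(\xi)=w$ and $K(\xi)=0$. Fix a connection $K=K_{T^*M\otimes TN}$ on $T^*M\otimes TN$. For a map $\upsilon\colon M\to T^*M\otimes TN$ that covers $u$, that is, $\upsilon(x)\in\mathcal{L}(T_xM,T_{u(x)}N)$, write $(\operatorname{Hor}_K\circ\upsilon)(x)[v]=\operatorname{Hor}_{K,\upsilon(x)}\bigl(v,\upsilon(x)[v]\bigr)$ for $v\in T_xM$, and, for a map $D$ with $D(x)\colon T_xM\times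 T_xM\to T_{u(x)}N$ bilinear, write $(\operatorname{Vert}\circ D)(x)[v]=\operatorname{Vert}_{\upsilon(x)}(D(x)[v])$, where $D(x)[v]=D(x)[v,\cdot]$. If $\upsilon$ is colocally weakly differentiable, a *colocal weak covariant derivative* of $\upsilon$ is a measurable map $D_K\upsilon\colon M\to T^*M\otimes T^*M\otimes TN$ that covers $u$ such that, for every $f\in C^1_c(T^*M\otimes TN,\mathbb{R})$, almost everywhere in $M$, $$(Tf)(\upsilon)[\operatorname{Vert}\circ D_K\upsilon]=T(f\circ\upsilon)-(Tf)(\upsilon)[\operatorname{Hor}_K\circ\upsilon].$$ **Proposition.** Let $u\colon M\to N$ be twice colocally weakly differentiable and let $Tu$ be its colocal weak derivative. Then the map $Tu\colon M\to T^*M\otimes TN$ has a colocal weak covariant derivative $D_K(Tu)\colon M\to T^*M\otimes T^*M\otimes TN$ if and only if it has a colocal weak derivative $T^2u\colon TM\to T(T^*M\otimes TN)$. Furthermore, each of them is unique up to equality almost everywhere in $M$, and almost everywhere in $M$ $$T^2u=\operatorname{Vert}\circ D_K(Tu)+\operatorname{Hor}_K\circ Tu\qquad\text{and}\qquad D_K(Tu)=K\circ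 T^2u.$$ -/

import Mathlib

open Bundle Set MeasureTheory
open scoped Manifold ContDiff Topology

noncomputable section

namespace Colocal

/-! ### Measure-theoretic notions on a manifold modelled on `ℝᵐ` -/

section Measure

variable {m : ℕ} {M : Type*} [TopologicalSpace M] [ChartedSpace (EuclideanSpace ℝ (Fin m)) M]

variable (m) in
/-- `P` holds almost everywhere on the manifold `M`: in every preferred chart, the set where it
fails is Lebesgue negligible. -/
def AlmostEverywhere (P : M → Prop) : Prop :=
  ∀ x₀ : M, ∀ᵐ y ∂(volume.restrict (chartAt (EuclideanSpace ℝ (Fin m)) x₀).target),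
    P ((chartAt (EuclideanSpace ℝ (Fin m)) x₀).symm y)

variable (m) in
/-- A map from the manifold `M` to a topological space is measurable: read in every preferred
chart, the inverse images of open sets are Lebesgue measurable. -/
def MeasurableMap {X : Type*} [TopologicalSpace X] (w : M → X) : Prop :=
  ∀ x₀ : M, ∀ O : Set X, IsOpen O →
    NullMeasurableSet ((chartAt (EuclideanSpace ℝ (Fin m)) x₀).target ∩
      (fun y ↦ w ((chartAt (EuclideanSpace ℝ (Fin m)) x₀).symm y)) ⁻¹' O) volume

/-- `θ` is a weak derivative of the function `g : M → ℝ`: in every preferred chart `φ`, the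
functions `g ∘ φ⁻¹` and `θ ∘ Tφ⁻¹` are locally integrable on the (open) image of the chart and
`θ ∘ Tφ⁻¹` is the distributional differential of `g ∘ φ⁻¹` there. -/
def IsWeakDerivative (g : M → ℝ) (θ : ∀ x : M, TangentSpace (𝓡 m) x →L[ℝ] ℝ) : Prop :=
  ∀ x₀ : M,
    let φ := chartAt (EuclideanSpace ℝ (Fin m)) x₀
    let dg : EuclideanSpace ℝ (Fin m) → (EuclideanSpace ℝ (Fin m) →L[ℝ] ℝ) :=
      fun y ↦ (θ (φ.symm y)).comp (mfderiv (𝓡 m) (𝓡 m) φ.symm y)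
    LocallyIntegrableOn (fun y ↦ g (φ.symm y)) φ.target volume ∧
    LocallyIntegrableOn dg φ.target volume ∧
    ∀ η : EuclideanSpace ℝ (Fin m) → ℝ, ContDiff ℝ ∞ η → HasCompactSupport η →
      tsupport η ⊆ φ.target → ∀ v : EuclideanSpace ℝ (Fin m),
        ∫ y in φ.target, g (φ.symm y) * fderiv ℝ η y v = - ∫ y in φ.target, dg y v * η y

variable (m) in
/-- The function `g : M → ℝ` is weakly differentiable, i.e. it is of class `W^{1,1}_loc`. -/
def WeaklyDifferentiable (g : M → ℝ) : Prop :=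
  ∃ θ : ∀ x : M, TangentSpace (𝓡 m) x →L[ℝ] ℝ, IsWeakDerivative g θ

end Measure

/-! ### Bundles -/

section Bundles

variable {E₁ : Type*} [NormedAddCommGroup E₁] [NormedSpace ℝ E₁]
  {H₁ : Type*} [TopologicalSpace H₁] (I : ModelWithCorners ℝ E₁ H₁)
  (M : Type*) [TopologicalSpace M] [ChartedSpace H₁ M]
  {E₂ : Type*} [NormedAddCommGroup E₂] [NormedSpace ℝ E₂]
  {H₂ : Type*} [TopologicalSpace H₂] (J : ModelWithCorners ℝ E₂ H₂)
  (N : Type*) [TopologicalSpace N] [ChartedSpace H₂ N]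

/-- The bundle `TM` seen over `M × N`: the pullback of `TM` by the first projection. -/
def PullTM (p : M × N) : Type _ := TangentSpace I p.1

instance (p : M × N) : TopologicalSpace (PullTM I M N p) :=
  inferInstanceAs (TopologicalSpace (TangentSpace I p.1))

instance (p : M × N) : AddCommGroup (PullTM I M N p) :=
  inferInstanceAs (AddCommGroup (TangentSpace I p.1))

instance (p : M × N) : Module ℝ (PullTM I M N p) :=
  inferInstanceAs (Module ℝ (TangentSpace I p.1))

instance (p : M × N) : IsTopologicalAddGroup (PullTM I M N p) :=
  inferInstanceAs (IsTopologicalAddGroup (TangentSpace I p.1))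

instance (p : M × N) : ContinuousSMul ℝ (PullTM I M N p) :=
  inferInstanceAs (ContinuousSMul ℝ (TangentSpace I p.1))

instance [IsManifold I 1 M] : TopologicalSpace (TotalSpace E₁ (PullTM I M N)) :=
  inferInstanceAs (TopologicalSpace (TotalSpace E₁
    ((ContinuousMap.fst : C(M × N, M)) *ᵖ (TangentSpace I : M → Type _))))

instance [IsManifold I 1 M] : FiberBundle E₁ (PullTM I M N) :=
  inferInstanceAs (FiberBundle E₁
    ((ContinuousMap.fst : C(M × N, M)) *ᵖ (TangentSpace I : M → Type _)))

instance [IsManifold I 1 M] : VectorBundle ℝ E₁ (PullTM I M N) :=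
  inferInstanceAs (VectorBundle ℝ E₁
    ((ContinuousMap.fst : C(M × N, M)) *ᵖ (TangentSpace I : M → Type _)))

instance [IsManifold I 2 M] : ContMDiffVectorBundle 1 E₁ (PullTM I M N) (I.prod J) :=
  inferInstanceAs (ContMDiffVectorBundle 1 E₁
    ((ContMDiffMap.fst : C^1⟮I.prod J, M × N; I, M⟯) *ᵖ (TangentSpace I : M → Type _)) (I.prod J))

/-- The bundle `TN` seen over `M × N`: the pullback of `TN` by the second projection. -/
def PullTN (p : M × N) : Type _ := TangentSpace J p.2

instance (p : M × N) : TopologicalSpace (PullTN M J N p) :=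
  inferInstanceAs (TopologicalSpace (TangentSpace J p.2))

instance (p : M × N) : AddCommGroup (PullTN M J N p) :=
  inferInstanceAs (AddCommGroup (TangentSpace J p.2))

instance (p : M × N) : Module ℝ (PullTN M J N p) :=
  inferInstanceAs (Module ℝ (TangentSpace J p.2))

instance (p : M × N) : IsTopologicalAddGroup (PullTN M J N p) :=
  inferInstanceAs (IsTopologicalAddGroup (TangentSpace J p.2))

instance (p : M × N) : ContinuousSMul ℝ (PullTN M J N p) :=
  inferInstanceAs (ContinuousSMul ℝ (TangentSpace J p.2))

instance [IsManifold J 1 N] : TopologicalSpace (TotalSpace E₂ (PullTN M J N)) :=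
  inferInstanceAs (TopologicalSpace (TotalSpace E₂
    ((ContinuousMap.snd : C(M × N, N)) *ᵖ (TangentSpace J : N → Type _))))

instance [IsManifold J 1 N] : FiberBundle E₂ (PullTN M J N) :=
  inferInstanceAs (FiberBundle E₂
    ((ContinuousMap.snd : C(M × N, N)) *ᵖ (TangentSpace J : N → Type _)))

instance [IsManifold J 1 N] : VectorBundle ℝ E₂ (PullTN M J N) :=
  inferInstanceAs (VectorBundle ℝ E₂
    ((ContinuousMap.snd : C(M × N, N)) *ᵖ (TangentSpace J : N → Type _)))

instance [IsManifold J 2 N] : ContMDiffVectorBundle 1 E₂ (PullTN M J N) (I.prod J) :=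
  inferInstanceAs (ContMDiffVectorBundle 1 E₂
    ((ContMDiffMap.snd : C^1⟮I.prod J, M × N; J, N⟯) *ᵖ (TangentSpace J : N → Type _)) (I.prod J))

/-- The vector bundle `T*M ⊗ TN` over `M × N`, with fibre `T*_x M ⊗ T_y N = L(T_x M, T_y N)`
over `(x, y)`. -/
abbrev HomTT : M × N → Type _ := fun p ↦ PullTM I M N p →L[ℝ] PullTN M J N p

/-- The vector bundle `T*M ⊗ T*M ⊗ TN` over `M × N`, with fibre `L(T_x M, L(T_x M, T_y N))`
(bilinear maps `T_x M × T_x M → T_y N`) over `(x, y)`. -/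
abbrev HomTTT : M × N → Type _ :=
  fun p ↦ PullTM I M N p →L[ℝ] HomTT I M J N p

end Bundles

/-! ### Connections on a vector bundle -/

section Connection

variable {EB : Type*} [NormedAddCommGroup EB] [NormedSpace ℝ EB]
  {HB : Type*} [TopologicalSpace HB] (IB : ModelWithCorners ℝ EB HB)
  {B : Type*} [TopologicalSpace B] [ChartedSpace HB B]
  (F : Type*) [NormedAddCommGroup F] [NormedSpace ℝ F]
  (E : B → Type*) [TopologicalSpace (TotalSpace F E)]
  [∀ b, AddCommGroup (E b)] [∀ b, Module ℝ (E b)] [∀ b, TopologicalSpace (E b)]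
  [FiberBundle F E]

variable {F E} in
/-- The velocity at time `0` of a curve in the total space of a vector bundle. -/
def velocity (γ : ℝ → TotalSpace F E) : TangentSpace (IB.prod 𝓘(ℝ, F)) (γ 0) :=
  mfderiv 𝓘(ℝ, ℝ) (IB.prod 𝓘(ℝ, F)) γ 0 (1 : ℝ)

variable {F E} in
/-- The vertical lift `Vert_e(ν) = d/dt (e + t ν) |_{t = 0}`, for `e` and `ν` in the same fibre. -/
def vertLift (e : TotalSpace F E) (ν : E e.proj) : TangentSpace (IB.prod 𝓘(ℝ, F)) e :=
  velocity IB (fun t : ℝ ↦ (⟨e.proj, e.2 + t • ν⟩ : TotalSpace F E))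

variable [VectorBundle ℝ F E] [IsManifold IB 1 B] [ContMDiffVectorBundle 1 F E IB]

/-- A connection (connector) on a vector bundle `π : E → B`: a continuous map `K : TE → E` that is
a bundle morphism from `TE → E` to `E → B` covering `π`, a bundle morphism from `Tπ : TE → TB` to
`E → B` covering `TB → B`, and such that `K ∘ Vert = id`.

The vector bundle operations of `Tπ : TE → TB` are the tangent maps of the fibrewise operations of
`E`: the vectors of `TE` with the same image under `Tπ` are the velocities of curves in `E` with
the same projection `c` on `B`, their sum is the velocity of the fibrewise sum of these curves, and
the product by a scalar `r` is the velocity of the fibrewise product by `r`. -/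
structure Connection where
  /-- the linear map `K_e : T_e E → E_{π e}` -/
  toFun : ∀ e : TotalSpace F E, TangentSpace (IB.prod 𝓘(ℝ, F)) e →L[ℝ] E e.proj
  continuous_toFun : Continuous
    (fun ξ : TangentBundle (IB.prod 𝓘(ℝ, F)) (TotalSpace F E) ↦
      (⟨ξ.proj.proj, toFun ξ.proj ξ.2⟩ : TotalSpace F E))
  map_vertLift : ∀ (e : TotalSpace F E) (ν : E e.proj), toFun e (vertLift IB e ν) = ν
  map_fiber_add : ∀ (c : ℝ → B) (a b : ∀ t, E (c t)),
    MDifferentiableAt 𝓘(ℝ, ℝ) (IB.prod 𝓘(ℝ, F)) (fun t ↦ (⟨c t, a t⟩ : TotalSpace F E)) 0 →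
    MDifferentiableAt 𝓘(ℝ, ℝ) (IB.prod 𝓘(ℝ, F)) (fun t ↦ (⟨c t, b t⟩ : TotalSpace F E)) 0 →
    toFun ⟨c 0, a 0 + b 0⟩ (velocity IB (fun t ↦ (⟨c t, a t + b t⟩ : TotalSpace F E))) =
      toFun ⟨c 0, a 0⟩ (velocity IB (fun t ↦ (⟨c t, a t⟩ : TotalSpace F E))) +
      toFun ⟨c 0, b 0⟩ (velocity IB (fun t ↦ (⟨c t, b t⟩ : TotalSpace F E)))
  map_fiber_smul : ∀ (r : ℝ) (c : ℝ → B) (a : ∀ t, E (c t)),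
    MDifferentiableAt 𝓘(ℝ, ℝ) (IB.prod 𝓘(ℝ, F)) (fun t ↦ (⟨c t, a t⟩ : TotalSpace F E)) 0 →
    toFun ⟨c 0, r • a 0⟩ (velocity IB (fun t ↦ (⟨c t, r • a t⟩ : TotalSpace F E))) =
      r • toFun ⟨c 0, a 0⟩ (velocity IB (fun t ↦ (⟨c t, a t⟩ : TotalSpace F E)))

variable {IB F E}

/-- The horizontal lift `Hor_K` at `e`: the linear map sending `w ∈ T_{π e} B` to the unique
`ξ ∈ T_e E` with `Tπ(ξ) = w` and `K(ξ) = 0`, that is, the inverse of the isomorphism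
`(Tπ, K) : T_e E → T_{π e} B × E_{π e}` applied to `(w, 0)`. -/
def Connection.horLift (K : Connection IB F E) (e : TotalSpace F E) :
    TangentSpace IB e.proj →L[ℝ] TangentSpace (IB.prod 𝓘(ℝ, F)) e :=
  (ContinuousLinearMap.inverse
    ((mfderiv (IB.prod 𝓘(ℝ, F)) IB (TotalSpace.proj : TotalSpace F E → B) e).prod
      (K.toFun e))).comp
    (ContinuousLinearMap.inl ℝ (TangentSpace IB e.proj) (E e.proj))

end Connection

/-! ### Colocal weak derivatives -/

section ColocalDerivative

variable {m : ℕ} {M : Type*} [TopologicalSpace M] [ChartedSpace (EuclideanSpace ℝ (Fin m)) M]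
  {E' : Type*} [NormedAddCommGroup E'] [NormedSpace ℝ E']
  {H' : Type*} [TopologicalSpace H'] (J : ModelWithCorners ℝ E' H')
  {N : Type*} [TopologicalSpace N] [ChartedSpace H' N]

/-- The value `(Tf)(y)[ξ]` of the differential of `f : N → ℝ` at `y ∈ N` on `ξ ∈ T_y N`. -/
def differential (f : N → ℝ) (y : N) (ξ : TangentSpace J y) : ℝ :=
  mfderiv J 𝓘(ℝ, ℝ) f y ξ

variable (m) in
/-- A map `u : M → N` is colocally weakly differentiable: it is measurable and `f ∘ u` is weakly
differentiable for every `f ∈ C¹_c(N, ℝ)`. -/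
def ColocallyWeaklyDifferentiable (u : M → N) : Prop :=
  MeasurableMap m u ∧ ∀ f : N → ℝ, ContMDiff J 𝓘(ℝ, ℝ) 1 f → HasCompactSupport f →
    WeaklyDifferentiable m (f ∘ u)

/-- A family of linear maps `U x : T_x M → T_{u x} N`, seen as a map `M → T*M ⊗ TN` that
covers `u`. -/
def toHom (u : M → N) (U : ∀ x : M, TangentSpace (𝓡 m) x →L[ℝ] TangentSpace J (u x)) (x : M) :
    TotalSpace (EuclideanSpace ℝ (Fin m) →L[ℝ] E') (HomTT (𝓡 m) M J N) :=
  ⟨(x, u x), U x⟩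

/-- `U` is a colocal weak derivative of the colocally weakly differentiable map `u : M → N`: it is
a measurable bundle morphism that covers `u` such that, for every `f ∈ C¹_c(N, ℝ)`,
`T(f ∘ u) = Tf ∘ U` almost everywhere in `M`. -/
def IsColocalWeakDerivative [IsManifold (𝓡 m) 1 M] [IsManifold J 1 N] (u : M → N)
    (U : ∀ x : M, TangentSpace (𝓡 m) x →L[ℝ] TangentSpace J (u x)) : Prop :=
  ColocallyWeaklyDifferentiable m J u ∧
  MeasurableMap m (toHom J u U) ∧
  ∀ (f : N → ℝ) (θ : ∀ x : M, TangentSpace (𝓡 m) x →L[ℝ] ℝ),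
    ContMDiff J 𝓘(ℝ, ℝ) 1 f → HasCompactSupport f → IsWeakDerivative (f ∘ u) θ →
    AlmostEverywhere m fun x : M ↦ ∀ v : TangentSpace (𝓡 m) x,
      θ x v = differential J f (u x) (U x v)

end ColocalDerivative

/-! ### Second order -/

section SecondOrder

variable {m n : ℕ}
  {M : Type*} [TopologicalSpace M] [ChartedSpace (EuclideanSpace ℝ (Fin m)) M]
  [IsManifold (𝓡 m) 2 M]
  {N : Type*} [TopologicalSpace N] [ChartedSpace (EuclideanSpace ℝ (Fin n)) N]
  [IsManifold (𝓡 n) 2 N]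

variable (m n) in
/-- The model with corners of the total space of `T*M ⊗ TN`. -/
abbrev modelHom := ((𝓡 m).prod (𝓡 n)).prod
  𝓘(ℝ, EuclideanSpace ℝ (Fin m) →L[ℝ] EuclideanSpace ℝ (Fin n))

variable (m n M N) in
/-- The total space of `T*M ⊗ TN`, a manifold of class `C¹`. -/
abbrev TotalHom := TotalSpace (EuclideanSpace ℝ (Fin m) →L[ℝ] EuclideanSpace ℝ (Fin n))
  (HomTT (𝓡 m) M (𝓡 n) N)

variable (m n M N) in
/-- Connections on the vector bundle `T*M ⊗ TN` over `M × N`. -/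
abbrev ConnectionHom := Connection ((𝓡 m).prod (𝓡 n))
  (EuclideanSpace ℝ (Fin m) →L[ℝ] EuclideanSpace ℝ (Fin n)) (HomTT (𝓡 m) M (𝓡 n) N)

variable (m n) in
/-- `u : M → N` is twice colocally weakly differentiable: it is colocally weakly differentiable and
its colocal weak derivative `Tu : M → T*M ⊗ TN` is colocally weakly differentiable. -/
def TwiceColocallyWeaklyDifferentiable (u : M → N) : Prop :=
  ColocallyWeaklyDifferentiable m (𝓡 n) u ∧
  ∃ U : ∀ x : M, TangentSpace (𝓡 m) x →L[ℝ] TangentSpace (𝓡 n) (u x),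
    IsColocalWeakDerivative (𝓡 n) u U ∧
    ColocallyWeaklyDifferentiable m (modelHom m n) (toHom (𝓡 n) u U)

/-- The term `(Hor_K ∘ υ)(x)[v]` for the map `υ = toHom u U : M → T*M ⊗ TN`: the horizontal lift at
`υ(x)` of the vector `(v, U(x)[v]) ∈ T_x M × T_{u(x)} N = T_{(x, u(x))} (M × N)`. -/
def horTerm (K : ConnectionHom m n M N) (u : M → N)
    (U : ∀ x : M, TangentSpace (𝓡 m) x →L[ℝ] TangentSpace (𝓡 n) (u x))
    (x : M) (v : TangentSpace (𝓡 m) x) :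
    TangentSpace (modelHom m n) (toHom (𝓡 n) u U x) :=
  K.horLift (toHom (𝓡 n) u U x) ((v, U x v) : TangentSpace (𝓡 m) x × TangentSpace (𝓡 n) (u x))

/-- The term `(Vert ∘ D)(x)[v]` for the map `υ = toHom u U : M → T*M ⊗ TN`: the vertical lift at
`υ(x)` of `D(x)[v] ∈ L(T_x M, T_{u(x)} N)`. -/
def vertTerm (u : M → N)
    (U : ∀ x : M, TangentSpace (𝓡 m) x →L[ℝ] TangentSpace (𝓡 n) (u x))
    (D : ∀ x : M, TangentSpace (𝓡 m) x →L[ℝ] TangentSpace (𝓡 m) x →L[ℝ] TangentSpace (𝓡 n) (u x))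
    (x : M) (v : TangentSpace (𝓡 m) x) :
    TangentSpace (modelHom m n) (toHom (𝓡 n) u U x) :=
  vertLift ((𝓡 m).prod (𝓡 n)) (toHom (𝓡 n) u U x) (D x v)

/-- `D` is a colocal weak covariant derivative, with respect to the connection `K`, of the
colocally weakly differentiable map `υ = toHom u U : M → T*M ⊗ TN` that covers `u`: it is a
measurable map `M → T*M ⊗ T*M ⊗ TN` that covers `u` and, for every `f ∈ C¹_c(T*M ⊗ TN, ℝ)`,
`(Tf)(υ)[Vert ∘ D] = T(f ∘ υ) - (Tf)(υ)[Hor_K ∘ υ]` almost everywhere in `M`. -/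
def IsColocalWeakCovariantDerivative (K : ConnectionHom m n M N) (u : M → N)
    (U : ∀ x : M, TangentSpace (𝓡 m) x →L[ℝ] TangentSpace (𝓡 n) (u x))
    (D : ∀ x : M, TangentSpace (𝓡 m) x →L[ℝ] TangentSpace (𝓡 m) x →L[ℝ]
      TangentSpace (𝓡 n) (u x)) : Prop :=
  ColocallyWeaklyDifferentiable m (modelHom m n) (toHom (𝓡 n) u U) ∧
  MeasurableMap m (fun x : M ↦ (⟨(x, u x), D x⟩ : TotalSpace
    (EuclideanSpace ℝ (Fin m) →L[ℝ] EuclideanSpace ℝ (Fin m) →L[ℝ] EuclideanSpace ℝ (Fin n))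
    (HomTTT (𝓡 m) M (𝓡 n) N))) ∧
  ∀ (f : TotalHom m n M N → ℝ) (θ : ∀ x : M, TangentSpace (𝓡 m) x →L[ℝ] ℝ),
    ContMDiff (modelHom m n) 𝓘(ℝ, ℝ) 1 f → HasCompactSupport f →
    IsWeakDerivative (f ∘ toHom (𝓡 n) u U) θ →
    AlmostEverywhere m fun x : M ↦ ∀ v : TangentSpace (𝓡 m) x,
      differential (modelHom m n) f (toHom (𝓡 n) u U x) (vertTerm u U D x v) =
        θ x v - differential (modelHom m n) f (toHom (𝓡 n) u U x) (horTerm K u U x v)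

end SecondOrder

end Colocal

end

/-! At each point e of the bundle E = T*M ⊗ TN over B = M × N, a connection gives an isomorphism
(Tπ, K) from T_eE onto T_{π(e)}B × E_{π(e)}. A colocal weak derivative W of Tu is thus determined by
its two components Tπ ∘ W and K ∘ W. The first is forced, Tπ(W[v]) = (v, Tu[v]) almost everywhere,
and the second is the covariant derivative. In one direction D = K ∘ W works. In the other, W is
obtained by applying the inverse of (Tπ, K) to ((v, Tu[v]), D[v]), and the two defining identities
differ only by moving the horizontal term across.

The analytic point is Tπ ∘ W = (id, Tu), that is, a chain rule for the projections of E on M and N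
(`IsColocalWeakDerivative.mfderiv_comp`). For g in C¹_c of the base, g ∘ π need not have compact
support in E, so it is not an admissible test function. It is multiplied by a cutoff χ in C¹_c(E);
the Leibniz rule for bounded weakly differentiable functions (`HasWeakDirDeriv.mul`, by mollifying
one factor) isolates the term in g, and χ is cancelled where it does not vanish.

The exceptional null set in each defining identity depends on the test function. Countably many
functions in C¹_c that separate tangent vectors at every point (`exists_countable_separating`) give
a common null set, which also yields both uniqueness statements.

Measurability passes through (Tπ, K) because a continuous injective map from a locally compact
second countable space to a Hausdorff space reflects it (`measurable_of_continuous_injective_comp`).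
Bundle morphisms are tested on local frames of TM. -/

noncomputable section

namespace Colocal

/-! ### Weak directional derivatives on open sets and the Leibniz rule -/

section WeakDirectionalDerivative

open Filter Convolution

theorem _root_.MeasureTheory.setIntegral_mul_eq_integral {E : Type*} [TopologicalSpace E]
    [MeasurableSpace E] {μ : Measure E} {Ω : Set E} {a η : E → ℝ} (hηΩ : tsupport η ⊆ Ω) :
    ∫ x in Ω, a x * η x ∂μ = ∫ x, a x * η x ∂μ := by
  refine setIntegral_eq_integral_of_forall_compl_eq_zero fun x hx ↦ ?_
  rw [image_eq_zero_of_notMem_tsupport (fun h ↦ hx (hηΩ h)), mul_zero]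

theorem _root_.MeasureTheory.LocallyIntegrableOn.integrable_mul_of_tsupport_subset
    {E : Type*} [NormedAddCommGroup E] [MeasurableSpace E] [BorelSpace E] {μ : Measure E}
    {Ω : Set E} {a η : E → ℝ} (ha : LocallyIntegrableOn a Ω μ) (hη : Continuous η)
    (hηc : HasCompactSupport η) (hηΩ : tsupport η ⊆ Ω) :
    Integrable (fun x ↦ a x * η x) μ := by
  have h1 : IntegrableOn a (tsupport η) μ := ha.integrableOn_compact_subset hηΩ hηc
  obtain ⟨C, hC⟩ := hη.bounded_above_of_compact_support hηc
  have h2 : IntegrableOn (fun x ↦ a x * η x) (tsupport η) μ :=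
    Integrable.mul_bdd (c := C) h1 hη.aestronglyMeasurable (Eventually.of_forall hC)
  refine (integrableOn_iff_integrable_of_support_subset ?_).1 h2
  intro x hx
  exact subset_tsupport η (right_ne_zero_of_mul hx)

variable {E : Type*} [NormedAddCommGroup E] [NormedSpace ℝ E]

theorem tsupport_fderiv_apply_subset (η : E → ℝ) (v : E) :
    tsupport (fun x ↦ fderiv ℝ η x v) ⊆ tsupport η := by
  refine closure_minimal (fun x hx ↦ ?_) (isClosed_tsupport η)
  refine support_fderiv_subset ℝ fun h ↦ hx ?_
  simp [h]

theorem _root_.HasCompactSupport.fderiv_apply_const {η : E → ℝ} (h : HasCompactSupport η) (v : E) :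
    HasCompactSupport (fun x ↦ fderiv ℝ η x v) :=
  h.of_isClosed_subset (isClosed_tsupport _) (tsupport_fderiv_apply_subset η v)

/-- Having κ equal to 1 near each point of K, not only on K, makes the derivative of κ vanish on K
as well. -/
theorem exists_contDiff_cutoff [FiniteDimensional ℝ E] {K Ω : Set E} (hK : IsCompact K)
    (hΩ : IsOpen Ω) (hKΩ : K ⊆ Ω) :
    ∃ κ : E → ℝ, ContDiff ℝ ∞ κ ∧ HasCompactSupport κ ∧ tsupport κ ⊆ Ω ∧
      ∀ x ∈ K, κ =ᶠ[𝓝 x] 1 := by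
  obtain ⟨K₁, hK₁, hKK₁, hK₁Ω⟩ := exists_compact_between hK hΩ hKΩ
  obtain ⟨K₂, hK₂, hKK₂, hK₂Ω⟩ := exists_compact_between hK isOpen_interior hKK₁
  obtain ⟨f, hf1, hf0, -⟩ := exists_contMDiffMap_one_nhds_of_subset_interior (n := ⊤) 𝓘(ℝ, E)
    hK.isClosed hKK₂
  have hs : tsupport f ⊆ K₁ := by
    refine closure_minimal (fun x hx ↦ ?_) hK₁.isClosed
    by_contra hx'
    exact hx (hf0 x fun h ↦ hx' (interior_subset (hK₂Ω h)))
  refine ⟨f, f.contMDiff.contDiff, hK₁.of_isClosed_subset (isClosed_tsupport _) hs,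
    hs.trans hK₁Ω, fun x hx ↦ ?_⟩
  exact hf1.filter_mono (nhds_le_nhdsSet hx)

variable [MeasurableSpace E] [BorelSpace E] {μ : Measure E}

/-- `a'` is the distributional derivative of `a` in the direction `v` on the open set `Ω`. -/
structure HasWeakDirDeriv (μ : Measure E) (Ω : Set E) (v : E) (a a' : E → ℝ) : Prop where
  locallyIntegrableOn : LocallyIntegrableOn a Ω μ
  locallyIntegrableOn_deriv : LocallyIntegrableOn a' Ω μ
  integral_eq : ∀ η : E → ℝ, ContDiff ℝ ∞ η → HasCompactSupport η → tsupport η ⊆ Ω →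
    ∫ y, a y * fderiv ℝ η y v ∂μ = - ∫ y, a' y * η y ∂μ

variable [FiniteDimensional ℝ E] [μ.IsAddHaarMeasure]

/-- Integration by parts on the whole space: the products with a test function are supported in Ω,
so the behaviour of `a` elsewhere is irrelevant. -/
theorem HasWeakDirDeriv.of_contDiffOn {Ω : Set E} (hΩ : IsOpen Ω) {a : E → ℝ}
    (ha : ContDiffOn ℝ 1 a Ω) (v : E) :
    HasWeakDirDeriv μ Ω v a (fun y ↦ fderiv ℝ a y v) := by
  have h1 : LocallyIntegrableOn a Ω μ :=
    ha.continuousOn.locallyIntegrableOn hΩ.measurableSet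
  have h2 : LocallyIntegrableOn (fun y ↦ fderiv ℝ a y v) Ω μ :=
    ((ha.continuousOn_fderiv_of_isOpen hΩ le_rfl).clm_apply
      continuousOn_const).locallyIntegrableOn hΩ.measurableSet
  refine ⟨h1, h2, fun η hη hηc hηΩ ↦ ?_⟩
  refine integral_mul_fderiv_eq_neg_fderiv_mul_of_integrable ?_ ?_ ?_ ?_ ?_
  · exact h2.integrable_mul_of_tsupport_subset hη.continuous hηc hηΩ
  · exact h1.integrable_mul_of_tsupport_subset
      ((hη.continuous_fderiv (by simp)).clm_apply continuous_const)
      (hηc.fderiv_apply_const v) ((tsupport_fderiv_apply_subset η v).trans hηΩ)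
  · exact h1.integrable_mul_of_tsupport_subset hη.continuous hηc hηΩ
  · exact fun x hx ↦ (ha.differentiableOn one_ne_zero).differentiableAt (hΩ.mem_nhds (hηΩ hx))
  · exact fun x _ ↦ hη.differentiable (by simp) x

/-- A relation `∫ q g + ∫ p ∂g = - ∫ r g`, valid for all smooth `g`, is still valid for a bounded
function with an integrable weak derivative. -/
theorem integral_add_integral_eq_of_contDiff {v : E} {a a' p q r : E → ℝ} {C D : ℝ}
    (ha : Integrable a μ) (ha' : Integrable a' μ) (hC : ∀ x, ‖a x‖ ≤ C)
    (haa' : ∀ η : E → ℝ, ContDiff ℝ ∞ η → HasCompactSupport η →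
      ∫ y, a y * fderiv ℝ η y v ∂μ = - ∫ y, a' y * η y ∂μ)
    (hp : Integrable p μ) (hD : ∀ x, ‖p x‖ ≤ D) (hq : Integrable q μ) (hr : Integrable r μ)
    (h : ∀ g : E → ℝ, ContDiff ℝ ∞ g →
      ∫ y, q y * g y ∂μ + ∫ y, p y * fderiv ℝ g y v ∂μ = - ∫ y, r y * g y ∂μ) :
    ∫ y, q y * a y ∂μ + ∫ y, p y * a' y ∂μ = - ∫ y, r y * a y ∂μ := by
  let φ : ℕ → ContDiffBump (0 : E) := fun i ↦
    ⟨1 / ((i : ℝ) + 1), 2 * (1 / ((i : ℝ) + 1)), by positivity, by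
      have : 0 < 1 / ((i : ℝ) + 1) := by positivity
      linarith⟩
  have hφ : Tendsto (fun i ↦ (φ i).rOut) atTop (𝓝 0) := by
    have := (tendsto_one_div_add_atTop_nhds_zero_nat (𝕜 := ℝ)).const_mul 2
    rwa [mul_zero] at this
  -- The fixed ratio 2 between outer and inner radius is what almost everywhere convergence of the
  -- mollifications uses when the function is merely locally integrable.
  have hφ' : ∀ᶠ i in atTop, (φ i).rOut ≤ 2 * (φ i).rIn := Eventually.of_forall fun i ↦ le_rfl
  let ρ : ℕ → E → ℝ := fun i ↦ (φ i).normed μ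
  have hρs : ∀ i, ContDiff ℝ ∞ (ρ i) := fun i ↦ (φ i).contDiff_normed
  have hρc : ∀ i, HasCompactSupport (ρ i) := fun i ↦ (φ i).hasCompactSupport_normed
  have hρi : ∀ i, Integrable (ρ i) μ := fun i ↦ (φ i).integrable_normed
  have hsymm : ∀ i x y, ρ i (x - y) = ρ i (y - x) := fun i x y ↦ by
    rw [← neg_sub]
    exact (φ i).normed_neg _
  -- the convolution, in a convenient form
  let m : ℕ → (E → ℝ) → E → ℝ := fun i f x ↦ ∫ y, ρ i (x - y) * f y ∂μ
  have hm : ∀ i f, ((ρ i) ⋆[ContinuousLinearMap.lsmul ℝ ℝ, μ] f) = m i f := fun i f ↦ by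
    ext x
    rw [convolution_eq_swap]
    rfl
  have hlim : ∀ f, Integrable f μ → ∀ᵐ x ∂μ, Tendsto (fun i ↦ m i f x) atTop (𝓝 (f x)) := by
    intro f hf
    have := ContDiffBump.ae_convolution_tendsto_right_of_locallyIntegrable hφ hφ'
      hf.locallyIntegrable
    filter_upwards [this] with x hx
    simpa only [← hm] using hx
  have hbd : ∀ f : E → ℝ, ∀ c : ℝ, (∀ x, ‖f x‖ ≤ c) → ∀ i x, ‖m i f x‖ ≤ c := by
    intro f c hc i x
    have h1 : ∫ y, ρ i (x - y) ∂μ = 1 := by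
      rw [integral_sub_left_eq_self]
      exact (φ i).integral_normed
    calc ‖m i f x‖ ≤ ∫ y, ρ i (x - y) * c ∂μ := by
          refine norm_integral_le_of_norm_le
            (((hρi i).comp_sub_left x).mul_const c) (Eventually.of_forall fun y ↦ ?_)
          rw [norm_mul, Real.norm_of_nonneg ((φ i).nonneg_normed _)]
          exact mul_le_mul_of_nonneg_left (hc y) ((φ i).nonneg_normed _)
      _ = c := by rw [integral_mul_const, h1, one_mul]
  have hsm : ∀ i, ContDiff ℝ ∞ (m i a) := fun i ↦ by
    rw [← hm]
    exact (hρc i).contDiff_convolution_left _ (hρs i) ha.locallyIntegrable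
  have hmeas : ∀ f, Integrable f μ → ∀ i, AEStronglyMeasurable (m i f) μ := by
    intro f hf i
    rw [← hm]
    exact ((hρi i).integrable_convolution (ContinuousLinearMap.lsmul ℝ ℝ) hf).aestronglyMeasurable
  -- Mollification commutes with the weak derivative: the test function is y ↦ ρ(x - y).
  have hder : ∀ i x, fderiv ℝ (m i a) x v = m i a' x := by
    intro i x
    have h1 := (hρc i).hasFDerivAt_convolution_left (ContinuousLinearMap.lsmul ℝ ℝ)
      ((hρs i).of_le (by simp)) ha.locallyIntegrable (μ := μ) x
    rw [hm] at h1
    rw [h1.fderiv, convolution_eq_swap]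
    have hint : Integrable (fun t ↦ ((ContinuousLinearMap.lsmul ℝ ℝ).precompL E)
        (fderiv ℝ (ρ i) (x - t)) (a t)) μ := by
      have hcc : Continuous (fderiv ℝ (ρ i)) := (hρs i).continuous_fderiv (by simp)
      exact ((((hρc i).fderiv ℝ).convolutionExists_left
        ((ContinuousLinearMap.lsmul ℝ ℝ : ℝ →L[ℝ] ℝ →L[ℝ] ℝ).precompL E) hcc
        ha.locallyIntegrable) x).integrable_swap
    rw [ContinuousLinearMap.integral_apply hint]
    have h2 := haa' (fun y ↦ ρ i (x - y)) ((hρs i).comp (contDiff_const.sub contDiff_id))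
      ((hρc i).comp_homeomorph (Homeomorph.subLeft x))
    have h3 : ∀ y, fderiv ℝ (fun y ↦ ρ i (x - y)) y v = - fderiv ℝ (ρ i) (x - y) v := by
      intro y
      have h4 : HasFDerivAt (fun y ↦ ρ i (x - y))
          ((fderiv ℝ (ρ i) (x - y)).comp (-ContinuousLinearMap.id ℝ E)) y :=
        ((hρs i).differentiable (by simp) _).hasFDerivAt.comp y ((hasFDerivAt_id y).const_sub x)
      rw [h4.fderiv]
      simp
    simp only [h3, mul_neg, integral_neg, neg_inj] at h2
    calc _ = ∫ y, a y * fderiv ℝ (ρ i) (x - y) v ∂μ := by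
          refine integral_congr_ae (Eventually.of_forall fun y ↦ ?_)
          simp [ContinuousLinearMap.precompL_apply, mul_comm]
      _ = _ := by
          rw [h2]
          exact integral_congr_ae (Eventually.of_forall fun y ↦ mul_comm _ _)
  -- The mollifier is even, so Fubini moves it from `a'`, which is only integrable, to the bounded
  -- function `p`. The limit can then be taken by domination.
  have hfub : ∀ i, ∫ x, p x * m i a' x ∂μ = ∫ y, m i p y * a' y ∂μ := by
    intro i
    have hI : Integrable (fun z : E × E ↦ p z.1 * (ρ i (z.1 - z.2) * a' z.2)) (μ.prod μ) := by
      have h1 := Integrable.convolution_integrand (μ := μ) (ν := μ)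
        (ContinuousLinearMap.lsmul ℝ ℝ).flip ha' (hρi i)
      refine Integrable.bdd_mul (c := D) ?_ ?_ (Eventually.of_forall fun z ↦ hD z.1)
      · simpa using h1
      · exact hp.aestronglyMeasurable.comp_fst
    calc ∫ x, p x * m i a' x ∂μ = ∫ x, ∫ y, p x * (ρ i (x - y) * a' y) ∂μ ∂μ := by
          simp only [m, integral_const_mul]
      _ = ∫ y, ∫ x, p x * (ρ i (x - y) * a' y) ∂μ ∂μ := integral_integral_swap hI
      _ = _ := by
          refine integral_congr_ae (Eventually.of_forall fun y ↦ ?_)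
          simp only [m]
          rw [← integral_mul_const]
          refine integral_congr_ae (Eventually.of_forall fun x ↦ ?_)
          simp only [hsymm i x y]
          ring
  have key : ∀ i, ∫ y, q y * m i a y ∂μ + ∫ y, m i p y * a' y ∂μ = - ∫ y, r y * m i a y ∂μ := by
    intro i
    rw [← h _ (hsm i), ← hfub]
    simp only [hder]
  have hT : ∀ f s : E → ℝ, ∀ c : ℝ, Integrable s μ → Integrable f μ → (∀ x, ‖f x‖ ≤ c) →
      Tendsto (fun i ↦ ∫ y, s y * m i f y ∂μ) atTop (𝓝 (∫ y, s y * f y ∂μ)) := by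
    intro f s c hs hf hc
    refine tendsto_integral_of_dominated_convergence (fun y ↦ ‖s y‖ * c)
      (fun i ↦ hs.aestronglyMeasurable.mul (hmeas f hf i)) (hs.norm.mul_const c)
      (fun i ↦ Eventually.of_forall fun y ↦ ?_) ?_
    · rw [norm_mul]
      exact mul_le_mul_of_nonneg_left (hbd f c hc i y) (norm_nonneg _)
    · filter_upwards [hlim f hf] with x hx
      exact hx.const_mul _
  have hT2 : Tendsto (fun i ↦ ∫ y, m i p y * a' y ∂μ) atTop (𝓝 (∫ y, p y * a' y ∂μ)) := by
    simpa only [mul_comm] using hT p a' D ha' hp hD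
  exact tendsto_nhds_unique (((hT a q C hq ha hC).add hT2).congr key) (hT a r C hr ha hC).neg

/-- For smooth g, testing `b` with η g gives a relation linear in g. It extends to g = κ a, with κ a
cutoff equal to 1 near the support of η, because κ a is bounded and integrable with integrable weak
derivative. Boundedness also makes the products with the derivatives locally integrable. -/
theorem HasWeakDirDeriv.mul {Ω : Set E} (hΩ : IsOpen Ω) {v : E} {a a' b b' : E → ℝ} {A B : ℝ}
    (ha : HasWeakDirDeriv μ Ω v a a') (hb : HasWeakDirDeriv μ Ω v b b')
    (hA : ∀ x, ‖a x‖ ≤ A) (hB : ∀ x, ‖b x‖ ≤ B) :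
    HasWeakDirDeriv μ Ω v (fun x ↦ a x * b x) (fun x ↦ a x * b' x + b x * a' x) := by
  have hbdd : ∀ {f g : E → ℝ} {c : ℝ}, LocallyIntegrableOn f Ω μ → LocallyIntegrableOn g Ω μ →
      (∀ x, ‖f x‖ ≤ c) → LocallyIntegrableOn (fun x ↦ f x * g x) Ω μ := by
    intro f g c hf hg hc
    rw [locallyIntegrableOn_iff hΩ.isLocallyClosed] at hg ⊢
    intro k hk hkc
    exact (hg k hk hkc).bdd_mul (c := c)
      (hf.integrableOn_compact_subset hk hkc).aestronglyMeasurable (Eventually.of_forall hc)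
  refine ⟨hbdd ha.1 hb.1 hA, (hbdd ha.1 hb.2 hA).add (hbdd hb.1 ha.2 hB),
    fun η hη hηc hηΩ ↦ ?_⟩
  have hη1 : Continuous fun x ↦ fderiv ℝ η x v :=
    (hη.continuous_fderiv (by simp)).clm_apply continuous_const
  have hη1c := hηc.fderiv_apply_const v
  have hη1Ω := (tsupport_fderiv_apply_subset η v).trans hηΩ
  obtain ⟨κ, hκ, hκc, hκΩ, hκ1⟩ := exists_contDiff_cutoff hηc hΩ hηΩ
  have hκ' : Continuous fun x ↦ fderiv ℝ κ x v :=
    (hκ.continuous_fderiv (by simp)).clm_apply continuous_const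
  have hκ'c := hκc.fderiv_apply_const v
  have hκ'Ω := (tsupport_fderiv_apply_subset κ v).trans hκΩ
  -- On the support of η the cutoff is invisible, derivative included, so it disappears from the
  -- final identity.
  have hκη : ∀ x, η x ≠ 0 → κ x = 1 ∧ fderiv ℝ κ x v = 0 := by
    intro x hx
    have h := hκ1 x (subset_tsupport η hx)
    refine ⟨h.eq_of_nhds, ?_⟩
    rw [h.fderiv_eq]
    simp
  have hκη' : ∀ x, fderiv ℝ η x v ≠ 0 → κ x = 1 := by
    intro x hx
    exact (hκ1 x (tsupport_fderiv_apply_subset η v (subset_tsupport _ hx))).eq_of_nhds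
  obtain ⟨cκ, hcκ⟩ := hκ.continuous.bounded_above_of_compact_support hκc
  obtain ⟨cη, hcη⟩ := hη.continuous.bounded_above_of_compact_support hηc
  have key := integral_add_integral_eq_of_contDiff (μ := μ) (v := v)
    (a := fun x ↦ a x * κ x) (a' := fun x ↦ a' x * κ x + a x * fderiv ℝ κ x v)
    (p := fun x ↦ b x * η x) (q := fun x ↦ b x * fderiv ℝ η x v) (r := fun x ↦ b' x * η x)
    (C := A * cκ) (D := B * cη)
    (ha.1.integrable_mul_of_tsupport_subset hκ.continuous hκc hκΩ)
    ((ha.2.integrable_mul_of_tsupport_subset hκ.continuous hκc hκΩ).add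
      (ha.1.integrable_mul_of_tsupport_subset hκ' hκ'c hκ'Ω))
    (fun x ↦ by
      rw [norm_mul]
      exact mul_le_mul (hA x) (hcκ x) (norm_nonneg _) ((norm_nonneg _).trans (hA x)))
    -- The weak derivative of a κ: test `a` with κ ψ.
    (fun ψ hψ hψc ↦ by
      have hd : ∀ x, fderiv ℝ (fun y ↦ κ y * ψ y) x v
          = κ x * fderiv ℝ ψ x v + ψ x * fderiv ℝ κ x v := by
        intro x
        rw [fderiv_fun_mul (hκ.differentiable (by simp) x) (hψ.differentiable (by simp) x)]
        simp
      have hψ1 : Continuous fun x ↦ fderiv ℝ ψ x v :=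
        (hψ.continuous_fderiv (by simp)).clm_apply continuous_const
      have h1 := ha.3 (fun y ↦ κ y * ψ y) (hκ.mul hψ) hκc.mul_right
        ((tsupport_mul_subset_left).trans hκΩ)
      have i1 : Integrable (fun y ↦ a y * (κ y * fderiv ℝ ψ y v)) μ :=
        ha.1.integrable_mul_of_tsupport_subset (hκ.continuous.mul hψ1) hκc.mul_right
          ((tsupport_mul_subset_left).trans hκΩ)
      have i2 : Integrable (fun y ↦ a y * (ψ y * fderiv ℝ κ y v)) μ :=
        ha.1.integrable_mul_of_tsupport_subset (hψ.continuous.mul hκ') hκ'c.mul_left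
          ((tsupport_mul_subset_right).trans hκ'Ω)
      have i3 : Integrable (fun y ↦ a' y * (κ y * ψ y)) μ :=
        ha.2.integrable_mul_of_tsupport_subset (hκ.continuous.mul hψ.continuous) hκc.mul_right
          ((tsupport_mul_subset_left).trans hκΩ)
      simp only [hd, mul_add] at h1
      rw [integral_add i1 i2] at h1
      have e1 : ∫ y, a y * κ y * fderiv ℝ ψ y v ∂μ = ∫ y, a y * (κ y * fderiv ℝ ψ y v) ∂μ := by
        simp only [mul_assoc]
      have e2 : ∫ y, (a' y * κ y + a y * fderiv ℝ κ y v) * ψ y ∂μ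
          = ∫ y, a' y * (κ y * ψ y) ∂μ + ∫ y, a y * (ψ y * fderiv ℝ κ y v) ∂μ := by
        rw [← integral_add i3 i2]
        refine integral_congr_ae (Eventually.of_forall fun y ↦ ?_)
        simp only
        ring
      rw [e1, e2]
      linarith)
    (hb.1.integrable_mul_of_tsupport_subset hη.continuous hηc hηΩ)
    (fun x ↦ by
      rw [norm_mul]
      exact mul_le_mul (hB x) (hcη x) (norm_nonneg _) ((norm_nonneg _).trans (hB x)))
    (hb.1.integrable_mul_of_tsupport_subset hη1 hη1c hη1Ω)
    (hb.2.integrable_mul_of_tsupport_subset hη.continuous hηc hηΩ)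
    -- The case of a smooth factor g: test `b` with η g, whose support is compact whatever that of
    -- g.
    (fun g hg ↦ by
      have hd : ∀ x, fderiv ℝ (fun y ↦ η y * g y) x v
          = η x * fderiv ℝ g x v + g x * fderiv ℝ η x v := by
        intro x
        rw [fderiv_fun_mul (hη.differentiable (by simp) x) (hg.differentiable (by simp) x)]
        simp
      have hg1 : Continuous fun x ↦ fderiv ℝ g x v :=
        (hg.continuous_fderiv (by simp)).clm_apply continuous_const
      have h1 := hb.3 (fun y ↦ η y * g y) (hη.mul hg) hηc.mul_right
        ((tsupport_mul_subset_left).trans hηΩ)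
      have i1 : Integrable (fun y ↦ b y * (η y * fderiv ℝ g y v)) μ :=
        hb.1.integrable_mul_of_tsupport_subset (hη.continuous.mul hg1) hηc.mul_right
          ((tsupport_mul_subset_left).trans hηΩ)
      have i2 : Integrable (fun y ↦ b y * (g y * fderiv ℝ η y v)) μ :=
        hb.1.integrable_mul_of_tsupport_subset (hg.continuous.mul hη1) hη1c.mul_left
          ((tsupport_mul_subset_right).trans hη1Ω)
      simp only [hd, mul_add] at h1
      rw [integral_add i1 i2] at h1
      have e1 : ∫ y, b y * fderiv ℝ η y v * g y ∂μ = ∫ y, b y * (g y * fderiv ℝ η y v) ∂μ :=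
        integral_congr_ae (Eventually.of_forall fun y ↦ by simp only; ring)
      have e2 : ∫ y, b y * η y * fderiv ℝ g y v ∂μ = ∫ y, b y * (η y * fderiv ℝ g y v) ∂μ :=
        integral_congr_ae (Eventually.of_forall fun y ↦ by simp only; ring)
      have e3 : ∫ y, b' y * η y * g y ∂μ = ∫ y, b' y * (η y * g y) ∂μ :=
        integral_congr_ae (Eventually.of_forall fun y ↦ by simp only; ring)
      rw [e1, e2, e3, add_comm]
      exact h1)
  have i4 : Integrable (fun x ↦ (a x * b' x) * η x) μ :=
    (hbdd ha.1 hb.2 hA).integrable_mul_of_tsupport_subset hη.continuous hηc hηΩ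
  have i5 : Integrable (fun x ↦ (b x * a' x) * η x) μ :=
    (hbdd hb.1 ha.2 hB).integrable_mul_of_tsupport_subset hη.continuous hηc hηΩ
  have e1 : ∫ x, b x * fderiv ℝ η x v * (a x * κ x) ∂μ = ∫ x, a x * b x * fderiv ℝ η x v ∂μ := by
    refine integral_congr_ae (Eventually.of_forall fun x ↦ ?_)
    by_cases hx : fderiv ℝ η x v = 0
    · simp [hx]
    · simp only [hκη' x hx]
      ring
  have e2 : ∫ x, b x * η x * (a' x * κ x + a x * fderiv ℝ κ x v) ∂μ
      = ∫ x, b x * a' x * η x ∂μ := by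
    refine integral_congr_ae (Eventually.of_forall fun x ↦ ?_)
    by_cases hx : η x = 0
    · simp [hx]
    · simp only [hκη x hx]
      ring
  have e3 : ∫ x, b' x * η x * (a x * κ x) ∂μ = ∫ x, a x * b' x * η x ∂μ := by
    refine integral_congr_ae (Eventually.of_forall fun x ↦ ?_)
    by_cases hx : η x = 0
    · simp [hx]
    · simp only [hκη x hx]
      ring
  rw [e1, e2, e3] at key
  simp only [add_mul]
  rw [integral_add i4 i5]
  linarith

end WeakDirectionalDerivative

/-! ### Weak derivatives of functions on the manifold -/

section WeakDerivative

variable {m : ℕ} {M : Type*} [TopologicalSpace M] [ChartedSpace (EuclideanSpace ℝ (Fin m)) M]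

theorem AlmostEverywhere.mono {P Q : M → Prop} (h : AlmostEverywhere m P) (hPQ : ∀ x, P x → Q x) :
    AlmostEverywhere m Q :=
  fun x₀ ↦ (h x₀).mono fun _ hy ↦ hPQ _ hy

theorem AlmostEverywhere.and {P Q : M → Prop} (hP : AlmostEverywhere m P)
    (hQ : AlmostEverywhere m Q) : AlmostEverywhere m fun x ↦ P x ∧ Q x :=
  fun x₀ ↦ (hP x₀).and (hQ x₀)

theorem AlmostEverywhere.forall {ι : Type*} [Countable ι] {P : ι → M → Prop}
    (h : ∀ i, AlmostEverywhere m (P i)) : AlmostEverywhere m fun x ↦ ∀ i, P i x :=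
  fun x₀ ↦ ae_all_iff.2 fun i ↦ h i x₀

/-- A covector field on `M`, read in the preferred chart at `x₀`. -/
def chartCovector (θ : ∀ x : M, TangentSpace (𝓡 m) x →L[ℝ] ℝ) (x₀ : M)
    (y : EuclideanSpace ℝ (Fin m)) : EuclideanSpace ℝ (Fin m) →L[ℝ] ℝ :=
  (θ ((chartAt (EuclideanSpace ℝ (Fin m)) x₀).symm y)).comp
    (mfderiv (𝓡 m) (𝓡 m) (chartAt (EuclideanSpace ℝ (Fin m)) x₀).symm y)

/-- Test functions are supported in the chart, so integrals over its image are integrals over the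
whole space and the directional theory applies. -/
theorem isWeakDerivative_iff {g : M → ℝ} {θ : ∀ x : M, TangentSpace (𝓡 m) x →L[ℝ] ℝ} :
    IsWeakDerivative g θ ↔ ∀ x₀ : M,
      LocallyIntegrableOn (chartCovector θ x₀) (chartAt (EuclideanSpace ℝ (Fin m)) x₀).target ∧
      ∀ v, HasWeakDirDeriv volume (chartAt (EuclideanSpace ℝ (Fin m)) x₀).target v
        (fun y ↦ g ((chartAt (EuclideanSpace ℝ (Fin m)) x₀).symm y))
        (fun y ↦ chartCovector θ x₀ y v) := by
  refine forall_congr' fun x₀ ↦ ?_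
  constructor
  · rintro ⟨h1, h2, h3⟩
    refine ⟨h2, fun v ↦ ⟨h1, ?_, fun η hη hηc hηΩ ↦ ?_⟩⟩
    · intro x hx
      obtain ⟨s, hs, hs'⟩ := h2 x hx
      exact ⟨s, hs, (ContinuousLinearMap.apply ℝ ℝ v).integrable_comp hs'⟩
    · have h := h3 η hη hηc hηΩ v
      rw [setIntegral_mul_eq_integral hηΩ, setIntegral_mul_eq_integral
        ((tsupport_fderiv_apply_subset η v).trans hηΩ)] at h
      exact h
  · rintro ⟨h2, h⟩
    refine ⟨(h 0).1, h2, fun η hη hηc hηΩ v ↦ ?_⟩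
    rw [setIntegral_mul_eq_integral hηΩ, setIntegral_mul_eq_integral
      ((tsupport_fderiv_apply_subset η v).trans hηΩ)]
    exact (h v).3 η hη hηc hηΩ

theorem IsWeakDerivative.mul {g h : M → ℝ} {θ τ : ∀ x : M, TangentSpace (𝓡 m) x →L[ℝ] ℝ}
    {A B : ℝ} (hg : IsWeakDerivative g θ) (hh : IsWeakDerivative h τ) (hA : ∀ x, ‖g x‖ ≤ A)
    (hB : ∀ x, ‖h x‖ ≤ B) :
    IsWeakDerivative (fun x ↦ g x * h x) (fun x ↦ g x • τ x + h x • θ x) := by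
  rw [isWeakDerivative_iff] at hg hh ⊢
  intro x₀
  have hΩ := (chartAt (EuclideanSpace ℝ (Fin m)) x₀).open_target
  have key : ∀ {f : M → ℝ} {σ : EuclideanSpace ℝ (Fin m) → (EuclideanSpace ℝ (Fin m) →L[ℝ] ℝ)}
      {C : ℝ}, LocallyIntegrableOn (fun y ↦ f ((chartAt (EuclideanSpace ℝ (Fin m)) x₀).symm y))
        (chartAt (EuclideanSpace ℝ (Fin m)) x₀).target → LocallyIntegrableOn σ
        (chartAt (EuclideanSpace ℝ (Fin m)) x₀).target → (∀ x, ‖f x‖ ≤ C) →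
      LocallyIntegrableOn (fun y ↦ f ((chartAt (EuclideanSpace ℝ (Fin m)) x₀).symm y) • σ y)
        (chartAt (EuclideanSpace ℝ (Fin m)) x₀).target := by
    intro f σ C hf hσ hC
    rw [locallyIntegrableOn_iff hΩ.isLocallyClosed] at hσ ⊢
    intro k hk hkc
    exact (hσ k hk hkc).bdd_smul C
      (hf.integrableOn_compact_subset hk hkc).aestronglyMeasurable
      (Filter.Eventually.of_forall fun y ↦ hC _)
  refine ⟨?_, fun v ↦ ?_⟩
  · have h1 := key ((hg x₀).2 0).1 (hh x₀).1 hA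
    have h2 := key ((hh x₀).2 0).1 (hg x₀).1 hB
    exact LocallyIntegrableOn.add (ε'' := EuclideanSpace ℝ (Fin m) →L[ℝ] ℝ) h1 h2
  exact ((hg x₀).2 v).mul hΩ ((hh x₀).2 v) (fun _ ↦ hA _) (fun _ ↦ hB _)

/-- The differential of a real-valued function on `M`, as a covector field. -/
def differentialCovector {m : ℕ} {M : Type*} [TopologicalSpace M]
    [ChartedSpace (EuclideanSpace ℝ (Fin m)) M] (g : M → ℝ) (x : M) : TangentSpace (𝓡 m) x →L[ℝ] ℝ :=
  mfderiv (𝓡 m) 𝓘(ℝ, ℝ) g x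

/-- This serves the first projection: composed with Tu it is the identity of M, so the functions to
differentiate are classical ones. -/
theorem isWeakDerivative_differentialCovector [IsManifold (𝓡 m) 1 M] {g : M → ℝ}
    (hg : ContMDiff (𝓡 m) 𝓘(ℝ, ℝ) 1 g) :
    IsWeakDerivative (m := m) g (differentialCovector g) := by
  rw [isWeakDerivative_iff]
  intro x₀
  have hΩ := (chartAt (EuclideanSpace ℝ (Fin m)) x₀).open_target
  have hC : ContDiffOn ℝ 1 (fun y ↦ g ((chartAt (EuclideanSpace ℝ (Fin m)) x₀).symm y))
      (chartAt (EuclideanSpace ℝ (Fin m)) x₀).target :=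
    contMDiffOn_iff_contDiffOn.1 (hg.comp_contMDiffOn (contMDiffOn_chart_symm (I := 𝓡 m)))
  have heq : ∀ y ∈ (chartAt (EuclideanSpace ℝ (Fin m)) x₀).target,
      chartCovector (differentialCovector g) x₀ y =
        fderiv ℝ (fun y ↦ g ((chartAt (EuclideanSpace ℝ (Fin m)) x₀).symm y)) y := by
    intro y hy
    rw [← mfderiv_eq_fderiv]
    exact (mfderiv_comp y (hg.mdifferentiable one_ne_zero _)
      ((mdifferentiable_chart (I := 𝓡 m) x₀).symm.mdifferentiableAt hy)).symm
  refine ⟨?_, fun v ↦ ?_⟩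
  · exact (hC.continuousOn_fderiv_of_isOpen hΩ le_rfl).congr heq
      |>.locallyIntegrableOn hΩ.measurableSet
  · have h := HasWeakDirDeriv.of_contDiffOn (μ := volume) hΩ hC v
    refine ⟨h.1, ?_, fun η hη hηc hηΩ ↦ ?_⟩
    · refine ContinuousOn.locallyIntegrableOn ?_ hΩ.measurableSet
      exact (((hC.continuousOn_fderiv_of_isOpen hΩ le_rfl).congr heq).clm_apply continuousOn_const)
    · rw [h.3 η hη hηc hηΩ]
      congr 1
      refine integral_congr_ae (Filter.Eventually.of_forall fun y ↦ ?_)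
      by_cases hy : y ∈ tsupport η
      · simp only [heq y (hηΩ hy)]
      · simp [image_eq_zero_of_notMem_tsupport hy]

end WeakDerivative

/-! ### Compactly supported functions separating tangent vectors -/

section BumpFunctions

open Filter

variable {E' : Type*} [NormedAddCommGroup E'] [NormedSpace ℝ E']
  {H' : Type*} [TopologicalSpace H'] (J : ModelWithCorners ℝ E' H')
  {P : Type*} [TopologicalSpace P] [ChartedSpace H' P]

/-- The extension by zero to a manifold of a function defined in a chart. -/
def chartExtension (p₀ : P) (ψ : E' → ℝ) : P → ℝ :=
  indicator (extChartAt J p₀).source (ψ ∘ extChartAt J p₀)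

variable {J}

theorem chartExtension_eventuallyEq {p₀ p : P} (ψ : E' → ℝ) (hp : p ∈ (extChartAt J p₀).source) :
    chartExtension J p₀ ψ =ᶠ[𝓝 p] ψ ∘ extChartAt J p₀ := by
  filter_upwards [(isOpen_extChartAt_source p₀).mem_nhds hp] with q hq
  exact indicator_of_mem hq _

/-- The image of the support is compact, hence closed in a Hausdorff space. The extension by zero
therefore creates no new support at the edge of the chart domain, and stays C¹. -/
theorem tsupport_chartExtension_subset [T2Space P] {p₀ : P} {ψ : E' → ℝ}
    (hψ : HasCompactSupport ψ) (hψt : tsupport ψ ⊆ (extChartAt J p₀).target) :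
    tsupport (chartExtension J p₀ ψ) ⊆ (extChartAt J p₀).symm '' tsupport ψ := by
  have hK : IsCompact ((extChartAt J p₀).symm '' tsupport ψ) :=
    IsCompact.image_of_continuousOn hψ ((continuousOn_extChartAt_symm p₀).mono hψt)
  refine closure_minimal (fun p hp ↦ ?_) hK.isClosed
  have h : p ∈ (extChartAt J p₀).source := by
    by_contra h
    exact hp (indicator_of_notMem h _)
  refine ⟨extChartAt J p₀ p, subset_tsupport ψ fun h0 ↦ hp ?_, (extChartAt J p₀).left_inv h⟩
  rw [(chartExtension_eventuallyEq ψ h).eq_of_nhds]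
  exact h0

theorem hasCompactSupport_chartExtension [T2Space P] {p₀ : P} {ψ : E' → ℝ}
    (hψ : HasCompactSupport ψ) (hψt : tsupport ψ ⊆ (extChartAt J p₀).target) :
    HasCompactSupport (chartExtension J p₀ ψ) :=
  (IsCompact.image_of_continuousOn hψ
    ((continuousOn_extChartAt_symm p₀).mono hψt)).of_isClosed_subset (isClosed_tsupport _)
    (tsupport_chartExtension_subset hψ hψt)

theorem contMDiff_chartExtension [IsManifold J 1 P] [T2Space P] {p₀ : P} {ψ : E' → ℝ}
    (hψs : ContDiff ℝ 1 ψ) (hψ : HasCompactSupport ψ)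
    (hψt : tsupport ψ ⊆ (extChartAt J p₀).target) :
    ContMDiff J 𝓘(ℝ, ℝ) 1 (chartExtension J p₀ ψ) := by
  refine contMDiff_of_tsupport fun p hp ↦ ?_
  obtain ⟨y, hy, rfl⟩ := tsupport_chartExtension_subset hψ hψt hp
  have h := (extChartAt J p₀).map_target (hψt hy)
  refine ContMDiffAt.congr_of_eventuallyEq ?_ (chartExtension_eventuallyEq ψ h)
  refine hψs.contMDiff.contMDiffAt.comp _ (contMDiffAt_extChartAt' ?_)
  rwa [extChartAt_source] at h

theorem differential_chartExtension [IsManifold J 1 P] {p₀ p : P} {ψ : E' → ℝ}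
    (hψs : ContDiff ℝ 1 ψ) (hp : p ∈ (chartAt H' p₀).source) (ξ : TangentSpace J p) :
    differential J (chartExtension J p₀ ψ) p ξ =
      fderiv ℝ ψ (extChartAt J p₀ p) (mfderiv J 𝓘(ℝ, E') (extChartAt J p₀) p ξ) := by
  have h : p ∈ (extChartAt J p₀).source := by rwa [extChartAt_source]
  have h1 := (chartExtension_eventuallyEq ψ h).mfderiv_eq (I := J) (I' := 𝓘(ℝ, ℝ))
  have h2 := mfderiv_comp p (I := J) (I' := 𝓘(ℝ, E')) (I'' := 𝓘(ℝ, ℝ)) (g := ψ)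
    (f := extChartAt J p₀) (hψs.contMDiff.mdifferentiableAt one_ne_zero)
    (mdifferentiableAt_extChartAt hp)
  rw [mfderiv_eq_fderiv] at h2
  exact congrArg (fun L : E' →L[ℝ] ℝ ↦ L ξ) (h1.trans h2)

variable (J) in
/-- Near any point, the tangent vectors of a manifold are separated by the differentials of finitely
many compactly supported functions of class `C¹`, one of which does not vanish. -/
theorem exists_finite_separating_nhds [FiniteDimensional ℝ E'] [J.Boundaryless]
    [IsManifold J 1 P] [T2Space P] (p₀ : P) :
    ∃ 𝓕 : Set (P → ℝ), 𝓕.Finite ∧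
      (∀ f ∈ 𝓕, ContMDiff J 𝓘(ℝ, ℝ) 1 f ∧ HasCompactSupport f) ∧
      ∀ᶠ p in 𝓝 p₀, (∃ f ∈ 𝓕, f p ≠ 0) ∧
        ∀ ξ₁ ξ₂ : TangentSpace J p, (∀ f ∈ 𝓕, differential J f p ξ₁ = differential J f p ξ₂) →
          ξ₁ = ξ₂ := by
  obtain ⟨κ, hκ, hκc, hκt, hκ1⟩ := exists_contDiff_cutoff (isCompact_singleton
    (x := extChartAt J p₀ p₀)) (isOpen_extChartAt_target (I := J) p₀)
    (singleton_subset_iff.2 (mem_extChartAt_target p₀))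
  let b := Module.finBasis ℝ E'
  let c : Fin (Module.finrank ℝ E') → E' →L[ℝ] ℝ :=
    fun i ↦ LinearMap.toContinuousLinearMap (b.coord i)
  -- The cutoff itself (`none`) is the nonvanishing function. The cutoff times a linear coordinate
  -- has, where κ is locally 1, that coordinate as differential.
  let ψ : Option (Fin (Module.finrank ℝ E')) → E' → ℝ :=
    fun o ↦ o.elim κ fun i y ↦ κ y * c i y
  have hκ' : ContDiff ℝ 1 κ := hκ.of_le (by simp)
  have hψs : ∀ o, ContDiff ℝ 1 (ψ o) := by
    rintro (_ | i)
    · exact hκ'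
    · exact hκ'.mul (c i).contDiff
  have hψc : ∀ o, HasCompactSupport (ψ o) := by
    rintro (_ | i)
    · exact hκc
    · exact hκc.mul_right
  have hψt : ∀ o, tsupport (ψ o) ⊆ (extChartAt J p₀).target := by
    rintro (_ | i)
    · exact hκt
    · exact tsupport_mul_subset_left.trans hκt
  refine ⟨range fun o ↦ chartExtension J p₀ (ψ o), finite_range _, ?_, ?_⟩
  · rintro _ ⟨o, rfl⟩
    exact ⟨contMDiff_chartExtension (hψs o) (hψc o) (hψt o),
      hasCompactSupport_chartExtension (hψc o) (hψt o)⟩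
  have h1 : ∀ᶠ p in 𝓝 p₀, κ =ᶠ[𝓝 (extChartAt J p₀ p)] 1 :=
    (continuousAt_extChartAt p₀).eventually (hκ1 _ rfl).eventuallyEq_nhds
  filter_upwards [h1, chart_source_mem_nhds H' p₀] with p hp hps
  have hps' : p ∈ (extChartAt J p₀).source := by rwa [extChartAt_source]
  refine ⟨⟨_, ⟨none, rfl⟩, ?_⟩, fun ξ₁ ξ₂ h ↦ ?_⟩
  · change chartExtension J p₀ (ψ none) p ≠ 0
    rw [(chartExtension_eventuallyEq _ hps').eq_of_nhds]
    change κ (extChartAt J p₀ p) ≠ 0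
    rw [hp.eq_of_nhds]
    exact one_ne_zero
  · have hinj : Function.Injective (mfderiv J 𝓘(ℝ, E') (extChartAt J p₀) p) :=
      (isInvertible_mfderiv_extChartAt hps').injective
    refine hinj (b.ext_elem fun i ↦ ?_)
    have hi := h _ ⟨some i, rfl⟩
    rw [differential_chartExtension (hψs _) hps, differential_chartExtension (hψs _) hps] at hi
    have hd : fderiv ℝ (ψ (some i)) (extChartAt J p₀ p) = c i := by
      have : ψ (some i) =ᶠ[𝓝 (extChartAt J p₀ p)] c i := by
        filter_upwards [hp] with y hy
        simp [ψ, hy]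
      rw [this.fderiv_eq]
      exact (c i).fderiv
    rw [hd] at hi
    exact hi

variable (J P) in
-- By the Lindelöf property countably many of the local finite families suffice.
theorem exists_countable_separating [FiniteDimensional ℝ E'] [J.Boundaryless]
    [IsManifold J 1 P] [T2Space P] [SecondCountableTopology P] :
    ∃ 𝓕 : Set (P → ℝ), 𝓕.Countable ∧
      (∀ f ∈ 𝓕, ContMDiff J 𝓘(ℝ, ℝ) 1 f ∧ HasCompactSupport f) ∧
      ∀ p : P, (∃ f ∈ 𝓕, f p ≠ 0) ∧
        ∀ ξ₁ ξ₂ : TangentSpace J p, (∀ f ∈ 𝓕, differential J f p ξ₁ = differential J f p ξ₂) →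
          ξ₁ = ξ₂ := by
  choose 𝓕 hfin hsm hev using exists_finite_separating_nhds J (P := P)
  obtain ⟨s, hs, hsu⟩ := TopologicalSpace.countable_cover_nhds hev
  refine ⟨⋃ p ∈ s, 𝓕 p, hs.biUnion fun p _ ↦ (hfin p).countable, ?_, fun p ↦ ?_⟩
  · intro f hf
    obtain ⟨p, -, hf⟩ := mem_iUnion₂.1 hf
    exact hsm p f hf
  · obtain ⟨q, hq, hpq⟩ := mem_iUnion₂.1 (hsu.symm ▸ mem_univ p : p ∈ ⋃ x ∈ s, _)
    obtain ⟨⟨f, hf, hfp⟩, hsep⟩ := hpq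
    exact ⟨⟨f, mem_biUnion hq hf, hfp⟩,
      fun ξ₁ ξ₂ h ↦ hsep ξ₁ ξ₂ fun f hf ↦ h f (mem_biUnion hq hf)⟩

end BumpFunctions

/-! ### Separation and countability of total spaces -/

section TotalSpaceTopology

variable {B : Type*} [TopologicalSpace B] {F : Type*} [TopologicalSpace F]
  {E : B → Type*} [TopologicalSpace (TotalSpace F E)] [∀ b, TopologicalSpace (E b)]
  [FiberBundle F E]

variable (F E) in
-- Two points of the same fibre are separated inside one trivialization, two points of different
-- fibres by preimages of open sets of the base.
theorem t2Space_totalSpace [T2Space B] [T2Space F] : T2Space (TotalSpace F E) := by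
  refine ⟨fun p q hpq ↦ ?_⟩
  by_cases h : p.proj = q.proj
  · let e := trivializationAt F E q.proj
    have hq : q ∈ e.source := FiberBundle.mem_trivializationAt_proj_source
    have hp : p ∈ e.source := by
      rw [e.mem_source, h]
      exact FiberBundle.mem_baseSet_trivializationAt' _
    obtain ⟨U, V, hU, hV, hpU, hqV, hUV⟩ := t2_separation (e.injOn.ne hp hq hpq)
    refine ⟨e.source ∩ e ⁻¹' U, e.source ∩ e ⁻¹' V, ?_, ?_, ⟨hp, hpU⟩, ⟨hq, hqV⟩, ?_⟩
    · exact e.continuousOn.isOpen_inter_preimage e.open_source hU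
    · exact e.continuousOn.isOpen_inter_preimage e.open_source hV
    · exact (hUV.preimage e).mono inter_subset_right inter_subset_right
  · obtain ⟨U, V, hU, hV, hpU, hqV, hUV⟩ := t2_separation h
    have hc := FiberBundle.continuous_proj F E
    exact ⟨_, _, hU.preimage hc, hV.preimage hc, hpU, hqV, hUV.preimage _⟩

variable (F E) in
theorem secondCountableTopology_totalSpace [SecondCountableTopology B]
    [SecondCountableTopology F] : SecondCountableTopology (TotalSpace F E) := by
  obtain ⟨s, hs, hsu⟩ := TopologicalSpace.countable_cover_nhds fun b : B ↦
    (trivializationAt F E b).open_baseSet.mem_nhds (FiberBundle.mem_baseSet_trivializationAt' b)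
  have := hs.to_subtype
  have hsc : ∀ b : s, SecondCountableTopology (trivializationAt F E b.1).source := fun b ↦
    (trivializationAt F E b.1).toOpenPartialHomeomorph.secondCountableTopology_source
  refine TopologicalSpace.secondCountableTopology_of_countable_cover
    (U := fun b : s ↦ (trivializationAt F E b.1).source)
    (fun b ↦ (trivializationAt F E b.1).toOpenPartialHomeomorph.open_source) ?_
  refine eq_univ_of_forall fun p ↦ ?_
  obtain ⟨b, hb, hpb⟩ := mem_iUnion₂.1 (hsu.symm ▸ mem_univ p.proj : p.proj ∈ ⋃ x ∈ s, _)
  exact mem_iUnion.2 ⟨⟨b, hb⟩, (Trivialization.mem_source _).2 hpb⟩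

end TotalSpaceTopology

/-! ### Measurability of maps and of sections of homomorphism bundles -/

section Measurability

/-- In a locally compact second countable space, open sets are countable unions of compact sets. -/
theorem _root_.IsOpen.exists_countable_isCompact_sUnion {X : Type*} [TopologicalSpace X]
    [LocallyCompactSpace X] [SecondCountableTopology X] {O : Set X} (hO : IsOpen O) :
    ∃ 𝒦 : Set (Set X), 𝒦.Countable ∧ (∀ k ∈ 𝒦, IsCompact k) ∧ O = ⋃₀ 𝒦 := by
  have h : ∀ x : X, ∃ k, IsCompact k ∧ k ⊆ O ∧ (x ∈ O → k ∈ 𝓝 x) := fun x ↦ by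
    by_cases hx : x ∈ O
    · obtain ⟨k, hk, hkO, hkc⟩ := local_compact_nhds (hO.mem_nhds hx)
      exact ⟨k, hkc, hkO, fun _ ↦ hk⟩
    · exact ⟨∅, isCompact_empty, empty_subset _, fun h ↦ absurd h hx⟩
  choose k hk hkO hkx using h
  obtain ⟨t, htO, ht, hOt⟩ := TopologicalSpace.countable_cover_nhdsWithin (s := O) (f := k)
    fun x hx ↦ mem_nhdsWithin_of_mem_nhds (hkx x hx)
  refine ⟨k '' t, ht.image k, ?_, ?_⟩
  · rintro _ ⟨x, -, rfl⟩
    exact hk x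
  · rw [sUnion_image]
    exact hOt.antisymm (iUnion₂_subset fun x _ ↦ hkO x)

/-- Open sets are countable unions of compact sets k. By injectivity the preimage of k under w is
that of Ψ(k) under Ψ ∘ w, and Ψ(k) is compact, hence closed. -/
theorem measurable_of_continuous_injective_comp {α X Z : Type*} [MeasurableSpace α]
    [TopologicalSpace X] [LocallyCompactSpace X] [SecondCountableTopology X]
    [MeasurableSpace X] [BorelSpace X] [TopologicalSpace Z] [T2Space Z] [MeasurableSpace Z]
    [BorelSpace Z] {w : α → X} {Ψ : X → Z} (hΨ : Continuous Ψ) (hinj : Function.Injective Ψ)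
    (hw : Measurable fun a ↦ Ψ (w a)) : Measurable w := by
  refine measurable_of_isOpen fun O hO ↦ ?_
  obtain ⟨𝒦, h𝒦, hc, rfl⟩ := hO.exists_countable_isCompact_sUnion
  rw [preimage_sUnion]
  refine MeasurableSet.biUnion h𝒦 fun k hk ↦ ?_
  have : w ⁻¹' k = (fun a ↦ Ψ (w a)) ⁻¹' (Ψ '' k) := by
    ext a
    simp only [mem_preimage]
    exact (hinj.mem_set_image).symm
  rw [this]
  exact hw ((hc k hk).image hΨ).measurableSet

/-- A map is measurable if its restrictions to the members of a countable measurable cover are. -/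
theorem measurable_of_restrict_iUnion {α X ι : Type*} [MeasurableSpace α] [MeasurableSpace X]
    [Countable ι] {S : ι → Set α} (hS : ∀ i, MeasurableSet (S i)) (hU : ⋃ i, S i = univ)
    {w : α → X} (hw : ∀ i, Measurable fun a : S i ↦ w a) : Measurable w := by
  intro O hO
  have : w ⁻¹' O = ⋃ i, Subtype.val '' ((fun a : S i ↦ w a) ⁻¹' O) := by
    ext a
    simp only [mem_preimage, mem_iUnion, mem_image, Subtype.exists, exists_and_right,
      exists_eq_right]
    obtain ⟨i, hi⟩ := mem_iUnion.1 (hU.symm ▸ mem_univ a : a ∈ ⋃ i, S i)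
    exact ⟨fun h ↦ ⟨i, hi, h⟩, fun ⟨_, _, h⟩ ↦ h⟩
  rw [this]
  exact MeasurableSet.iUnion fun i ↦ (hS i).subtype_image (hw i hO)

theorem _root_.ContinuousOn.measurable_comp {α X Y : Type*} [MeasurableSpace α]
    [TopologicalSpace X] [MeasurableSpace X] [BorelSpace X] [TopologicalSpace Y]
    [MeasurableSpace Y] [BorelSpace Y] {f : X → Y} {U : Set X} (hf : ContinuousOn f U)
    {w : α → X} (hw : Measurable w) (hwU : ∀ a, w a ∈ U) : Measurable fun a ↦ f (w a) :=
  hf.domRestrict.measurable.comp (hw.subtype_mk (h := hwU))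

/-- Evaluation on a basis is a continuous injection into a finite power of the target. -/
theorem measurable_clm_of_apply {α F₁ F₂ : Type*} [MeasurableSpace α]
    [NormedAddCommGroup F₁] [NormedSpace ℝ F₁] [FiniteDimensional ℝ F₁]
    [NormedAddCommGroup F₂] [NormedSpace ℝ F₂] [FiniteDimensional ℝ F₂] {T : α → F₁ →L[ℝ] F₂}
    [MeasurableSpace F₂] [BorelSpace F₂]
    [MeasurableSpace (F₁ →L[ℝ] F₂)] [BorelSpace (F₁ →L[ℝ] F₂)]
    (hT : ∀ v, Measurable fun a ↦ T a v) : Measurable T := by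
  let b := Module.finBasis ℝ F₁
  have : ProperSpace (F₁ →L[ℝ] F₂) := FiniteDimensional.proper ℝ _
  have : ProperSpace F₂ := FiniteDimensional.proper ℝ _
  refine measurable_of_continuous_injective_comp
    (Ψ := fun (L : F₁ →L[ℝ] F₂) (i : Fin (Module.finrank ℝ F₁)) ↦ L (b i)) (by fun_prop) ?_ ?_
  · intro L L' h
    ext x
    exact congrArg (fun l : F₁ →ₗ[ℝ] F₂ ↦ l x) (b.ext (f₁ := L.toLinearMap) (f₂ := L'.toLinearMap)
      fun i ↦ congrFun h i)
  · exact measurable_pi_lambda _ fun i ↦ hT _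

variable {B : Type*} [TopologicalSpace B]
  {F₁ : Type*} [NormedAddCommGroup F₁] [NormedSpace ℝ F₁]
  {E₁ : B → Type*} [∀ b, AddCommGroup (E₁ b)] [∀ b, Module ℝ (E₁ b)]
  [∀ b, TopologicalSpace (E₁ b)] [TopologicalSpace (TotalSpace F₁ E₁)]
  [FiberBundle F₁ E₁] [VectorBundle ℝ F₁ E₁]
  {F₂ : Type*} [NormedAddCommGroup F₂] [NormedSpace ℝ F₂]
  {E₂ : B → Type*} [∀ b, AddCommGroup (E₂ b)] [∀ b, Module ℝ (E₂ b)]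
  [∀ b, TopologicalSpace (E₂ b)] [TopologicalSpace (TotalSpace F₂ E₂)]
  [FiberBundle F₂ E₂] [VectorBundle ℝ F₂ E₂]
  [∀ b, IsTopologicalAddGroup (E₂ b)] [∀ b, ContinuousSMul ℝ (E₂ b)]
  [MeasurableSpace (TotalSpace F₂ E₂)] [BorelSpace (TotalSpace F₂ E₂)]
  [MeasurableSpace (TotalSpace (F₁ →L[ℝ] F₂) (fun b ↦ E₁ b →L[ℝ] E₂ b))]
  [BorelSpace (TotalSpace (F₁ →L[ℝ] F₂) (fun b ↦ E₁ b →L[ℝ] E₂ b))]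
  {α : Type*} [MeasurableSpace α]

/-- The evaluations of a measurable section of a bundle of homomorphisms, along a local frame, are
measurable. -/
theorem measurable_hom_apply {c : α → B} {T : ∀ a, E₁ (c a) →L[ℝ] E₂ (c a)}
    (hT : Measurable fun a ↦ (⟨c a, T a⟩ : TotalSpace (F₁ →L[ℝ] F₂) (fun b ↦ E₁ b →L[ℝ] E₂ b)))
    (e : Trivialization F₁ (TotalSpace.proj : TotalSpace F₁ E₁ → B)) [MemTrivializationAtlas e]
    (hc : ∀ a, c a ∈ e.baseSet) (v : F₁) :
    Measurable fun a ↦ (⟨c a, T a (e.symm (c a) v)⟩ : TotalSpace F₂ E₂) := by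
  let Y := TotalSpace (F₁ →L[ℝ] F₂) (fun b ↦ E₁ b →L[ℝ] E₂ b)
  have hproj : Continuous (TotalSpace.proj : Y → B) := FiberBundle.continuous_proj _ _
  have h1 : ContinuousOn (fun y : Y ↦ (⟨y.proj, y.2⟩ : Y)) (TotalSpace.proj ⁻¹' e.baseSet) :=
    continuousOn_id
  have h2 : ContinuousOn (fun y : Y ↦ (⟨y.proj, e.symm y.proj v⟩ : TotalSpace F₁ E₁))
      (TotalSpace.proj ⁻¹' e.baseSet) :=
    e.continuousOn_symm.comp (f := fun y : Y ↦ (y.proj, v))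
      (hproj.prodMk continuous_const).continuousOn fun y hy ↦ ⟨hy, mem_univ _⟩
  exact (h1.clm_bundle_apply h2).measurable_comp hT hc

variable [MeasurableSpace B] [BorelSpace B] [FiniteDimensional ℝ F₁] [FiniteDimensional ℝ F₂]

/-- A section of a bundle of homomorphisms is measurable if its evaluations along local frames
are. -/
theorem measurable_hom_of_apply [SecondCountableTopology B]
    {c : α → B} (hcm : Measurable c) {T : ∀ a, E₁ (c a) →L[ℝ] E₂ (c a)}
    (hT : ∀ (b₀ : B) (v : F₁), Measurable fun a : c ⁻¹' (trivializationAt F₁ E₁ b₀).baseSet ↦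
      (⟨c a, T a ((trivializationAt F₁ E₁ b₀).symm (c a) v)⟩ : TotalSpace F₂ E₂)) :
    Measurable fun a ↦
      (⟨c a, T a⟩ : TotalSpace (F₁ →L[ℝ] F₂) (fun b ↦ E₁ b →L[ℝ] E₂ b)) := by
  have : ProperSpace (F₁ →L[ℝ] F₂) := FiniteDimensional.proper ℝ _
  borelize (F₁ →L[ℝ] F₂) F₂
  let e₁ := fun b₀ : B ↦ trivializationAt F₁ E₁ b₀
  let e₂ := fun b₀ : B ↦ trivializationAt F₂ E₂ b₀
  let e := fun b₀ : B ↦ trivializationAt (F₁ →L[ℝ] F₂) (fun b ↦ E₁ b →L[ℝ] E₂ b) b₀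
  obtain ⟨s, hs, hsu⟩ := TopologicalSpace.countable_cover_nhds fun b : B ↦
    (e b).open_baseSet.mem_nhds (FiberBundle.mem_baseSet_trivializationAt' b)
  have := hs.to_subtype
  refine measurable_of_restrict_iUnion (S := fun b : s ↦ c ⁻¹' (e b).baseSet)
    (fun b ↦ hcm (e b).open_baseSet.measurableSet) ?_ fun b ↦ ?_
  · rw [← preimage_iUnion, iUnion_coe_set, hsu, preimage_univ]
  have hbase : (e b).baseSet = (e₁ b).baseSet ∩ (e₂ b).baseSet := hom_trivializationAt_baseSet _ _
  -- The matrix of `T` in the trivialization. Its value on a vector is the fibre coordinate of `T`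
  -- on the corresponding frame vector, and the section is recovered from it by the continuous
  -- inverse trivialization.
  let A : c ⁻¹' (e b).baseSet → (F₁ →L[ℝ] F₂) := fun a ↦ (e b ⟨c a, T a⟩).2
  have hA : Measurable A := by
    refine measurable_clm_of_apply fun v ↦ ?_
    have h1 : Measurable fun a : c ⁻¹' (e b).baseSet ↦
        (⟨c a, T a ((e₁ b).symm (c a) v)⟩ : TotalSpace F₂ E₂) :=
      (hT b v).comp (measurable_inclusion (s := c ⁻¹' (e b).baseSet)
        (preimage_mono (hbase.subset.trans inter_subset_left)))
    have h2 : ContinuousOn (fun y ↦ (e₂ b y).2) (e₂ b).source :=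
      continuous_snd.comp_continuousOn (e₂ b).continuousOn
    have hmem : ∀ a : c ⁻¹' (e b).baseSet, c a ∈ (e₁ b).baseSet ∩ (e₂ b).baseSet :=
      fun a ↦ hbase.subset a.2
    have h3 := h2.measurable_comp h1 fun a ↦ (Trivialization.mem_source _).2 (hmem a).2
    convert h3 using 2 with a
    change ((trivializationAt (F₁ →L[ℝ] F₂) (fun b ↦ E₁ b →L[ℝ] E₂ b) b.1) ⟨c a, T a⟩).2 v = _
    rw [hom_trivializationAt_apply]
    change ContinuousLinearMap.inCoordinates F₁ E₁ F₂ E₂ b.1 (c a) b.1 (c a) (T a) v = _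
    rw [ContinuousLinearMap.inCoordinates_eq (hmem a).1 (hmem a).2]
    rfl
  have h4 : Measurable fun a : c ⁻¹' (e b).baseSet ↦ (c a, A a) :=
    (hcm.comp measurable_subtype_coe).prodMk hA
  have h5 := (e b).continuousOn_symm.measurable_comp h4 fun a ↦ ⟨a.2, mem_univ _⟩
  convert h5 using 2 with a
  have hs : (⟨c a, T a⟩ : TotalSpace (F₁ →L[ℝ] F₂) (fun b ↦ E₁ b →L[ℝ] E₂ b)) ∈ (e b).source :=
    (Trivialization.mem_source _).2 a.2
  have h6 := (e b).symm_apply_mk_proj hs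
  rw [← (e b).mk_symm a.2] at h6
  exact h6.symm

end Measurability

/-! ### The splitting of the tangent space defined by a connection -/

section ConnectionSplitting

variable {EB : Type*} [NormedAddCommGroup EB] [NormedSpace ℝ EB]
  {HB : Type*} [TopologicalSpace HB] {IB : ModelWithCorners ℝ EB HB}
  {B : Type*} [TopologicalSpace B] [ChartedSpace HB B]
  {F : Type*} [NormedAddCommGroup F] [NormedSpace ℝ F]
  {E : B → Type*} [TopologicalSpace (TotalSpace F E)]
  [∀ b, TopologicalSpace (E b)] [FiberBundle F E]

theorem mdifferentiable_proj :
    MDifferentiable (IB.prod 𝓘(ℝ, F)) IB (TotalSpace.proj : TotalSpace F E → B) :=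
  (contMDiff_proj (n := 1) E).mdifferentiable one_ne_zero

variable [∀ b, AddCommGroup (E b)] [∀ b, Module ℝ (E b)] [VectorBundle ℝ F E]

/-- In a trivialization the line is affine in t. This guarantees that `vertLift` is a true
derivative and not the default value 0 of `mfderiv`. -/
theorem contMDiffAt_fiber_line (b : B) (x ν : E b) (t : ℝ) :
    ContMDiffAt 𝓘(ℝ, ℝ) (IB.prod 𝓘(ℝ, F)) 1
      (fun t : ℝ ↦ (⟨b, x + t • ν⟩ : TotalSpace F E)) t := by
  rw [contMDiffAt_totalSpace]
  refine ⟨contMDiffAt_const, ?_⟩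
  let L := (trivializationAt F E b).linearMapAt ℝ b
  have hb : b ∈ (trivializationAt F E b).baseSet := FiberBundle.mem_baseSet_trivializationAt' b
  have h : ∀ s : ℝ, ((trivializationAt F E b) ⟨b, x + s • ν⟩).2 = L x + s • L ν := by
    intro s
    rw [← map_smul, ← map_add]
    exact (congrFun ((trivializationAt F E b).coe_linearMapAt_of_mem (R := ℝ) hb) _).symm
  simp only [h]
  exact (contDiff_const.add (contDiff_id.smul contDiff_const)).contMDiff.contMDiffAt

theorem mfderiv_proj_vertLift (e : TotalSpace F E) (ν : E e.proj) :
    mfderiv (IB.prod 𝓘(ℝ, F)) IB (TotalSpace.proj : TotalSpace F E → B) e (vertLift IB e ν) = 0 := by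
  let γ : ℝ → TotalSpace F E := fun t ↦ ⟨e.proj, e.2 + t • ν⟩
  -- The curve starts at e + 0 • ν, which is only propositionally e. The point is therefore
  -- generalized and the tangent vector read in the model space.
  have key : ∀ p, γ 0 = p → ∀ ξ : EB × F, ξ = velocity IB γ →
      mfderiv (IB.prod 𝓘(ℝ, F)) IB (TotalSpace.proj : TotalSpace F E → B) p ξ = (0 : EB) := by
    rintro p rfl ξ rfl
    have h1 := mfderiv_comp (I := 𝓘(ℝ, ℝ)) (I' := IB.prod 𝓘(ℝ, F)) (I'' := IB) (0 : ℝ)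
      (mdifferentiable_proj (E := E) (F := F) (IB := IB) (γ 0))
      ((contMDiffAt_fiber_line e.proj e.2 ν 0).mdifferentiableAt one_ne_zero)
    have h2 : (TotalSpace.proj : TotalSpace F E → B) ∘ γ = fun _ ↦ e.proj := rfl
    have h3 : mfderiv 𝓘(ℝ, ℝ) IB ((TotalSpace.proj : TotalSpace F E → B) ∘ γ) 0 (1 : ℝ)
        = (0 : EB) := by
      rw [h2, mfderiv_const]
      rfl
    rw [← h3]
    exact (congrArg (fun L : ℝ →L[ℝ] EB ↦ L 1) h1).symm
  exact key e (by simp [γ]) _ rfl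

variable [ContMDiffVectorBundle 1 F E IB]

/-- The local section through e that is constant in a trivialization is a right inverse of the
projection, and so is its differential. -/
theorem surjective_mfderiv_proj (e : TotalSpace F E) : Function.Surjective
    (mfderiv (IB.prod 𝓘(ℝ, F)) IB (TotalSpace.proj : TotalSpace F E → B) e) := by
  let t := trivializationAt F E e.proj
  have he : e ∈ t.source := FiberBundle.mem_trivializationAt_proj_source
  have hb : e.proj ∈ t.baseSet := FiberBundle.mem_baseSet_trivializationAt' _
  let σ : B → TotalSpace F E := fun b ↦ t.toOpenPartialHomeomorph.symm (b, (t e).2)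
  have hσe : σ e.proj = e := t.symm_apply_mk_proj he
  have hσ : MDifferentiableAt IB (IB.prod 𝓘(ℝ, F)) σ e.proj := by
    have h1 : ContMDiffOn (IB.prod 𝓘(ℝ, F)) (IB.prod 𝓘(ℝ, F)) 1 t.toOpenPartialHomeomorph.symm
      t.target := t.contMDiffOn_symm
    have h2 : ContMDiffAt IB (IB.prod 𝓘(ℝ, F)) 1 (fun b : B ↦ (b, (t e).2)) e.proj :=
      contMDiffAt_id.prodMk contMDiffAt_const
    have hmem : (e.proj, (t e).2) ∈ t.target := t.mem_target.2 hb
    exact ((h1.contMDiffAt (t.open_target.mem_nhds hmem)).comp e.proj h2).mdifferentiableAt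
      one_ne_zero
  have hid : (TotalSpace.proj : TotalSpace F E → B) ∘ σ =ᶠ[𝓝 e.proj] id := by
    filter_upwards [t.open_baseSet.mem_nhds hb] with b hb
    exact t.proj_symm_apply (x := (b, (t e).2)) (t.mem_target.2 hb)
  have key : ∀ p, σ e.proj = p → ∀ w : EB, ∃ ξ : EB × F,
      mfderiv (IB.prod 𝓘(ℝ, F)) IB (TotalSpace.proj : TotalSpace F E → B) p ξ = w := by
    rintro p rfl w
    refine ⟨mfderiv IB (IB.prod 𝓘(ℝ, F)) σ e.proj w, ?_⟩
    have h1 := mfderiv_comp (I := IB) (I' := IB.prod 𝓘(ℝ, F)) (I'' := IB) e.proj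
      (mdifferentiable_proj (E := E) (F := F) (IB := IB) (σ e.proj)) hσ
    rw [hid.mfderiv_eq, mfderiv_id] at h1
    exact (congrArg (fun L : EB →L[ℝ] EB ↦ L w) h1).symm
  exact key e hσe

namespace Connection

variable [IsManifold IB 1 B] (K : Connection IB F E)

/-- The pair `(Tπ, K) : T_e E → T_{π e} B × E_{π e}`. -/
def splitting (e : TotalSpace F E) :
    TangentSpace (IB.prod 𝓘(ℝ, F)) e →L[ℝ] TangentSpace IB e.proj × E e.proj :=
  (mfderiv (IB.prod 𝓘(ℝ, F)) IB (TotalSpace.proj : TotalSpace F E → B) e).prod (K.toFun e)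

/-- Any lift of w can be corrected by a vertical vector, which changes its image under K at will and
leaves its projection alone. -/
theorem surjective_splitting (e : TotalSpace F E) : Function.Surjective (K.splitting e) := by
  rintro ⟨w, ν⟩
  obtain ⟨ξ, hξ⟩ := surjective_mfderiv_proj e w
  refine ⟨ξ + vertLift IB e (ν - K.toFun e ξ), Prod.ext ?_ ?_⟩
  · change mfderiv (IB.prod 𝓘(ℝ, F)) IB (TotalSpace.proj : TotalSpace F E → B) e _ = _
    rw [map_add, hξ, mfderiv_proj_vertLift, add_zero]
  · change K.toFun e _ = _
    rw [map_add, K.map_vertLift, add_sub_cancel]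

variable [FiniteDimensional ℝ EB] [FiniteDimensional ℝ F]

/-- Source and target have the same finite dimension, so surjectivity is enough. Invertibility is
what makes `horLift` meaningful, since `ContinuousLinearMap.inverse` is 0 on noninvertible maps. -/
theorem isInvertible_splitting (e : TotalSpace F E) : (K.splitting e).IsInvertible := by
  let L : E e.proj ≃L[ℝ] F := (trivializationAt F E e.proj).continuousLinearEquivAt ℝ e.proj
    (FiberBundle.mem_baseSet_trivializationAt' _)
  let G : (TangentSpace IB e.proj × E e.proj) ≃L[ℝ] EB × F :=
    (ContinuousLinearEquiv.refl ℝ EB).prodCongr L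
  let S : EB × F →L[ℝ] EB × F := (G : _ →L[ℝ] EB × F).comp (K.splitting e)
  have hsurj : Function.Surjective S := G.surjective.comp (K.surjective_splitting e)
  have hinj : Function.Injective S := LinearMap.injective_iff_surjective.2 hsurj
  let S' : (EB × F) ≃L[ℝ] EB × F := ContinuousLinearEquiv.ofBijective S
    (LinearMap.ker_eq_bot.2 hinj) (LinearMap.range_eq_top.2 hsurj)
  refine ⟨S'.trans G.symm, ?_⟩
  ext1 ξ
  exact G.symm_apply_apply _

theorem ext_splitting {e : TotalSpace F E} {ξ₁ ξ₂ : TangentSpace (IB.prod 𝓘(ℝ, F)) e}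
    (h : mfderiv (IB.prod 𝓘(ℝ, F)) IB (TotalSpace.proj : TotalSpace F E → B) e ξ₁ =
      mfderiv (IB.prod 𝓘(ℝ, F)) IB (TotalSpace.proj : TotalSpace F E → B) e ξ₂)
    (h' : K.toFun e ξ₁ = K.toFun e ξ₂) : ξ₁ = ξ₂ :=
  (K.isInvertible_splitting e).injective (Prod.ext h h')

theorem splitting_inverse (e : TotalSpace F E) (z : TangentSpace IB e.proj × E e.proj) :
    K.splitting e ((K.splitting e).inverse z) = z := by
  obtain ⟨S, hS⟩ := K.isInvertible_splitting e
  rw [← hS, ContinuousLinearMap.inverse_equiv]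
  exact S.apply_symm_apply z

theorem splitting_horLift (e : TotalSpace F E) (w : TangentSpace IB e.proj) :
    K.splitting e (K.horLift e w) = (w, 0) :=
  K.splitting_inverse e (w, 0)

theorem mfderiv_proj_horLift (e : TotalSpace F E) (w : TangentSpace IB e.proj) :
    mfderiv (IB.prod 𝓘(ℝ, F)) IB (TotalSpace.proj : TotalSpace F E → B) e (K.horLift e w) = w :=
  congrArg Prod.fst (K.splitting_horLift e w)

theorem toFun_horLift (e : TotalSpace F E) (w : TangentSpace IB e.proj) :
    K.toFun e (K.horLift e w) = 0 :=
  congrArg Prod.snd (K.splitting_horLift e w)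

end Connection

end ConnectionSplitting

/-! ### The Lebesgue σ-algebra of the manifold -/

section LebesgueMeasurable

variable (m : ℕ) (M : Type*) [TopologicalSpace M] [ChartedSpace (EuclideanSpace ℝ (Fin m)) M]

/-- The `σ`-algebra of the sets which are Lebesgue measurable in the preferred charts. -/
@[reducible]
def lebesgueMeasurableSpace : MeasurableSpace M where
  MeasurableSet' S := ∀ x₀ : M, NullMeasurableSet
    ((chartAt (EuclideanSpace ℝ (Fin m)) x₀).target ∩
      (chartAt (EuclideanSpace ℝ (Fin m)) x₀).symm ⁻¹' S) volume
  measurableSet_empty x₀ := by simp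
  measurableSet_compl S hS x₀ := by
    have h := (chartAt (EuclideanSpace ℝ (Fin m)) x₀).open_target.measurableSet.nullMeasurableSet
      (μ := volume)
    convert h.diff (hS x₀) using 1
    ext y
    simp
  measurableSet_iUnion S hS x₀ := by
    rw [preimage_iUnion, inter_iUnion]
    exact NullMeasurableSet.iUnion fun i ↦ hS i x₀

variable {m M}

/-- Chartwise measurability becomes measurability for a single σ-algebra, to which the general
criteria apply. -/
theorem measurableMap_iff {X : Type*} [TopologicalSpace X] [MeasurableSpace X] [BorelSpace X]
    {w : M → X} :
    MeasurableMap m w ↔ @Measurable M X (lebesgueMeasurableSpace m M) _ w := by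
  let _ := lebesgueMeasurableSpace m M
  constructor
  · intro h
    exact measurable_of_isOpen fun O hO x₀ ↦ h x₀ O hO
  · intro h x₀ O hO
    exact h hO.measurableSet x₀

variable (m M) in
-- M carries two σ-algebras, Lebesgue and Borel; the former contains the latter.
theorem measurable_id_lebesgue :
    @Measurable M M (lebesgueMeasurableSpace m M) (borel M) id := by
  borelize M
  refine measurableMap_iff.1 ?_
  intro x₀ O hO
  exact ((chartAt (EuclideanSpace ℝ (Fin m)) x₀).isOpen_inter_preimage_symm
    hO).measurableSet.nullMeasurableSet

end LebesgueMeasurable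

theorem measurable_of_isInducing_comp {α X Z : Type*} [MeasurableSpace α]
    [TopologicalSpace X] [MeasurableSpace X] [BorelSpace X] [TopologicalSpace Z]
    [MeasurableSpace Z] [BorelSpace Z] {w : α → X} {Ψ : X → Z} (hΨ : Topology.IsInducing Ψ)
    (hw : Measurable fun a ↦ Ψ (w a)) : Measurable w := by
  refine measurable_of_isOpen fun O hO ↦ ?_
  obtain ⟨V, hV, rfl⟩ := hΨ.isOpen_iff.1 hO
  exact hw hV.measurableSet

/-! ### Local frames and measurability for T*M ⊗ TN -/

section PullbackBundles

variable {E₁ : Type*} [NormedAddCommGroup E₁] [NormedSpace ℝ E₁]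
  {H₁ : Type*} [TopologicalSpace H₁] {I : ModelWithCorners ℝ E₁ H₁}
  {M : Type*} [TopologicalSpace M] [ChartedSpace H₁ M] [IsManifold I 1 M]
  {E₂ : Type*} [NormedAddCommGroup E₂] [NormedSpace ℝ E₂]
  {H₂ : Type*} [TopologicalSpace H₂] {J : ModelWithCorners ℝ E₂ H₂}
  {N : Type*} [TopologicalSpace N] [ChartedSpace H₂ N]

/-- The local frame of `TM` given by the trivialization at `x₀`. -/
def localFrame (I : ModelWithCorners ℝ E₁ H₁) [IsManifold I 1 M] (x₀ : M) (v : E₁) (x : M) :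
    TangentSpace I x :=
  (trivializationAt E₁ (TangentSpace I : M → Type _) x₀).symm x v

/-- A trivialization of the pullback is the one of TM at the first component, so its frames do not
depend on the point of N. -/
theorem trivializationAt_pullTM_symm {b₀ b : M × N} (hb : b.1 ∈
    (trivializationAt E₁ (TangentSpace I : M → Type _) b₀.1).baseSet) (v : E₁) :
    (trivializationAt E₁ (PullTM I M N) b₀).symm b v = localFrame I b₀.1 v b.1 := by
  let e := trivializationAt E₁ (PullTM I M N) b₀
  let e' := trivializationAt E₁ (TangentSpace I : M → Type _) b₀.1
  have hb' : b ∈ e.baseSet := hb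
  have h1 : e ⟨b, localFrame I b₀.1 v b.1⟩ = (b, v) := by
    have h2 : e' ⟨b.1, e'.symm b.1 v⟩ = (b.1, v) := e'.apply_mk_symm hb v
    have h3 : (e' ⟨b.1, e'.symm b.1 v⟩).2 = v := congrArg Prod.snd h2
    exact Prod.ext rfl h3
  have h3 := e.symm_apply_apply_mk hb' (localFrame I b₀.1 v b.1)
  rw [h1] at h3
  exact h3

variable [IsManifold J 1 N]

theorem continuous_pullTN_snd : Continuous
    (fun z : TotalSpace E₂ (PullTN M J N) ↦ (⟨z.proj.2, z.2⟩ : TangentBundle J N)) :=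
  Pullback.continuous_lift (F := E₂) (TangentSpace J : N → Type _)
    (ContinuousMap.snd : C(M × N, N))

theorem isInducing_pullTN : Topology.IsInducing
    (fun z : TotalSpace E₂ (PullTN M J N) ↦ (z.proj, (⟨z.proj.2, z.2⟩ : TangentBundle J N))) :=
  inducing_pullbackTotalSpaceEmbedding (F := E₂) (E := (TangentSpace J : N → Type _))
    (ContinuousMap.snd : C(M × N, N))

variable {α : Type*} [MeasurableSpace α]

theorem measurable_localFrame [MeasurableSpace M] [BorelSpace M]
    [MeasurableSpace (TangentBundle I M)] [BorelSpace (TangentBundle I M)] {p : α → M}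
    (hp : Measurable p) {x₀ : M}
    (hpx : ∀ a, p a ∈ (trivializationAt E₁ (TangentSpace I : M → Type _) x₀).baseSet) (v : E₁) :
    Measurable fun a ↦ (⟨p a, localFrame I x₀ v (p a)⟩ : TangentBundle I M) := by
  let e := trivializationAt E₁ (TangentSpace I : M → Type _) x₀
  have h : ContinuousOn (fun x ↦ (⟨x, e.symm x v⟩ : TangentBundle I M)) e.baseSet :=
    e.continuousOn_symm.comp (f := fun x ↦ (x, v)) (by fun_prop) fun y hy ↦ ⟨hy, mem_univ _⟩
  exact h.measurable_comp hp hpx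

variable [MeasurableSpace (TangentBundle J N)] [BorelSpace (TangentBundle J N)]
  [MeasurableSpace (TotalSpace (E₁ →L[ℝ] E₂) (HomTT I M J N))]
  [BorelSpace (TotalSpace (E₁ →L[ℝ] E₂) (HomTT I M J N))]

theorem measurable_homTT_apply {p : α → M} {w : α → N}
    {W : ∀ a, TangentSpace I (p a) →L[ℝ] TangentSpace J (w a)}
    (hW : Measurable fun a ↦
      (⟨(p a, w a), W a⟩ : TotalSpace (E₁ →L[ℝ] E₂) (HomTT I M J N))) {x₀ : M}
    (hp : ∀ a, p a ∈ (trivializationAt E₁ (TangentSpace I : M → Type _) x₀).baseSet) (v : E₁) :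
    Measurable fun a ↦ (⟨w a, W a (localFrame I x₀ v (p a))⟩ : TangentBundle J N) := by
  -- A point of `α` supplies some point of N at which to centre a pullback trivialization; which one
  -- is immaterial, since the base set restricts only the component in M.
  rcases isEmpty_or_nonempty α with h | ⟨⟨a₀⟩⟩
  · exact measurable_of_empty _
  borelize (TotalSpace E₂ (PullTN M J N))
  have h1 := measurable_hom_apply (E₁ := PullTM I M N) (E₂ := PullTN M J N)
    (c := fun a ↦ (p a, w a)) (T := W) hW (trivializationAt E₁ (PullTM I M N) (x₀, w a₀)) hp v
  convert continuous_pullTN_snd.measurable.comp h1 using 1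
  funext a
  exact congrArg (fun ξ : TangentSpace I (p a) ↦ (⟨w a, W a ξ⟩ : TangentBundle J N))
    (trivializationAt_pullTM_symm (b₀ := (x₀, w a₀)) (b := (p a, w a)) (hp a) v).symm

variable [MeasurableSpace M] [BorelSpace M] [MeasurableSpace N] [BorelSpace N]

theorem measurable_homTT_of_apply [FiniteDimensional ℝ E₁] [FiniteDimensional ℝ E₂]
    [SecondCountableTopology M] [SecondCountableTopology N] {p : α → M} {w : α → N}
    (hp : Measurable p) (hw : Measurable w)
    {W : ∀ a, TangentSpace I (p a) →L[ℝ] TangentSpace J (w a)}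
    (hW : ∀ (x₀ : M) (v : E₁), Measurable
      fun a : p ⁻¹' (trivializationAt E₁ (TangentSpace I : M → Type _) x₀).baseSet ↦
        (⟨w a, W a (localFrame I x₀ v (p a))⟩ : TangentBundle J N)) :
    Measurable fun a ↦
      (⟨(p a, w a), W a⟩ : TotalSpace (E₁ →L[ℝ] E₂) (HomTT I M J N)) := by
  borelize (TotalSpace E₂ (PullTN M J N))
  have := FiniteDimensional.proper ℝ E₂
  have := secondCountableTopology_totalSpace E₂ (TangentSpace J : N → Type _)
  refine measurable_hom_of_apply (E₁ := PullTM I M N) (E₂ := PullTN M J N)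
    (c := fun a ↦ (p a, w a)) (T := W) (hp.prodMk hw) fun b₀ v ↦ ?_
  have h1 := ((hp.comp measurable_subtype_coe).prodMk (hw.comp measurable_subtype_coe)).prodMk
    (hW b₀.1 v)
  refine measurable_of_isInducing_comp isInducing_pullTN ?_
  refine (congrArg Measurable (funext fun a ↦ ?_)).mpr h1
  exact congrArg (fun ξ : TangentSpace I (p a) ↦
    ((p a, w a), (⟨w a, W a ξ⟩ : TangentBundle J N)))
    (trivializationAt_pullTM_symm (b₀ := b₀) (b := (p a, w a)) a.2 v)

end PullbackBundles

/-! ### Uniqueness and the chain rule for colocal weak derivatives -/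

section ChainRule

variable {m : ℕ} {M : Type*} [TopologicalSpace M] [ChartedSpace (EuclideanSpace ℝ (Fin m)) M]
  {E' : Type*} [NormedAddCommGroup E'] [NormedSpace ℝ E']
  {H' : Type*} [TopologicalSpace H'] {J : ModelWithCorners ℝ E' H'}
  {P : Type*} [TopologicalSpace P] [ChartedSpace H' P]
  {E'' : Type*} [NormedAddCommGroup E''] [NormedSpace ℝ E'']
  {H'' : Type*} [TopologicalSpace H''] {JQ : ModelWithCorners ℝ E'' H''}
  {Q : Type*} [TopologicalSpace Q] [ChartedSpace H'' Q]

theorem differential_add (f : P → ℝ) (y : P) (ξ₁ ξ₂ : TangentSpace J y) :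
    differential J f y (ξ₁ + ξ₂) = differential J f y ξ₁ + differential J f y ξ₂ :=
  map_add (mfderiv J 𝓘(ℝ, ℝ) f y) ξ₁ ξ₂

theorem differential_mul_comp {χ : P → ℝ} {g : Q → ℝ} {p : P → Q} {y : P}
    (hχ : MDifferentiableAt J 𝓘(ℝ, ℝ) χ y) (hg : MDifferentiableAt JQ 𝓘(ℝ, ℝ) g (p y))
    (hp : MDifferentiableAt J JQ p y) (ξ : TangentSpace J y) :
    differential J (fun z ↦ χ z * g (p z)) y ξ =
      χ y * differential JQ g (p y) (mfderiv J JQ p y ξ) + g (p y) * differential J χ y ξ := by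
  have h := hχ.hasMFDerivAt.mul (hg.hasMFDerivAt.comp y hp.hasMFDerivAt)
  exact congrArg (fun L : E' →L[ℝ] ℝ ↦ L ξ) h.mfderiv

/-- Maps into tangent spaces are almost everywhere equal if their images by the differentials of
compactly supported functions of class `C¹` are. -/
theorem AlmostEverywhere.of_forall_differential_eq [FiniteDimensional ℝ E'] [J.Boundaryless]
    [IsManifold J 1 P] [T2Space P] [SecondCountableTopology P] {w : M → P}
    {ξ₁ ξ₂ : ∀ x : M, TangentSpace (𝓡 m) x → TangentSpace J (w x)}
    (h : ∀ f : P → ℝ, ContMDiff J 𝓘(ℝ, ℝ) 1 f → HasCompactSupport f →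
      AlmostEverywhere m fun x ↦ ∀ v, differential J f (w x) (ξ₁ x v) =
        differential J f (w x) (ξ₂ x v)) :
    AlmostEverywhere m fun x ↦ ∀ v, ξ₁ x v = ξ₂ x v := by
  obtain ⟨𝓕, h𝓕, hsm, hsep⟩ := exists_countable_separating J P
  have := h𝓕.to_subtype
  refine (AlmostEverywhere.forall fun f : 𝓕 ↦ h f (hsm f f.2).1 (hsm f f.2).2).mono fun x hx v ↦ ?_
  exact (hsep (w x)).2 _ _ fun f hf ↦ hx ⟨f, hf⟩ v

variable [IsManifold (𝓡 m) 1 M]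

theorem IsColocalWeakDerivative.ae_eq [FiniteDimensional ℝ E'] [J.Boundaryless]
    [IsManifold J 1 P] [T2Space P] [SecondCountableTopology P] {w : M → P}
    {W₁ W₂ : ∀ x : M, TangentSpace (𝓡 m) x →L[ℝ] TangentSpace J (w x)}
    (h₁ : IsColocalWeakDerivative J w W₁) (h₂ : IsColocalWeakDerivative J w W₂) :
    AlmostEverywhere m fun x ↦ W₁ x = W₂ x := by
  refine (AlmostEverywhere.of_forall_differential_eq (J := J) (w := w) (ξ₁ := fun x v ↦ W₁ x v)
    (ξ₂ := fun x v ↦ W₂ x v) fun f hf hfc ↦ ?_).mono fun x hx ↦ ContinuousLinearMap.ext hx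
  obtain ⟨θ, hθ⟩ := h₁.1.2 f hf hfc
  refine ((h₁.2.2 f θ hf hfc hθ).and (h₂.2.2 f θ hf hfc hθ)).mono fun x hx v ↦ ?_
  rw [← hx.1, ← hx.2]

/-- The chain rule `Tp ∘ Tw = T(p ∘ w)` for a map `p` of class `C¹` between manifolds and a map
`w` with a colocal weak derivative. -/
theorem IsColocalWeakDerivative.mfderiv_comp [FiniteDimensional ℝ E'] [J.Boundaryless]
    [IsManifold J 1 P] [T2Space P] [SecondCountableTopology P]
    [FiniteDimensional ℝ E''] [JQ.Boundaryless]
    [IsManifold JQ 1 Q] [T2Space Q] [SecondCountableTopology Q] {p : P → Q}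
    (hp : ContMDiff J JQ 1 p) {w : M → P}
    {W : ∀ x : M, TangentSpace (𝓡 m) x →L[ℝ] TangentSpace J (w x)}
    (hW : IsColocalWeakDerivative J w W)
    {V : ∀ x : M, TangentSpace (𝓡 m) x →L[ℝ] TangentSpace JQ (p (w x))}
    (hV : ∀ g : Q → ℝ, ContMDiff JQ 𝓘(ℝ, ℝ) 1 g → HasCompactSupport g →
      ∃ θ, IsWeakDerivative (fun x ↦ g (p (w x))) θ ∧
        AlmostEverywhere m fun x ↦ ∀ v, θ x v = differential JQ g (p (w x)) (V x v)) :
    AlmostEverywhere m fun x ↦ ∀ v, mfderiv J JQ p (w x) (W x v) = V x v := by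
  obtain ⟨𝓕, h𝓕, hsm, hsep⟩ := exists_countable_separating J P
  have := h𝓕.to_subtype
  refine AlmostEverywhere.of_forall_differential_eq (J := JQ) (w := fun x ↦ p (w x))
    (ξ₁ := fun x v ↦ mfderiv J JQ p (w x) (W x v)) (ξ₂ := fun x v ↦ V x v) fun g hg hgc ↦ ?_
  obtain ⟨θ, hθ, hθV⟩ := hV g hg hgc
  obtain ⟨B, hB⟩ := hg.continuous.bounded_above_of_compact_support hgc
  -- The function g ∘ p may fail to have compact support, but χ · (g ∘ p) is an admissible test
  -- function. Its weak derivative along w is computed both from `W` and by the Leibniz rule; the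
  -- terms containing the derivative of χ agree and cancel.
  have key : ∀ χ : 𝓕, AlmostEverywhere m fun x ↦ ∀ v, χ.1 (w x) *
      differential JQ g (p (w x)) (mfderiv J JQ p (w x) (W x v)) =
        χ.1 (w x) * differential JQ g (p (w x)) (V x v) := by
    rintro ⟨χ, hχ⟩
    obtain ⟨hχs, hχc⟩ := hsm χ hχ
    obtain ⟨A, hA⟩ := hχs.continuous.bounded_above_of_compact_support hχc
    obtain ⟨τ, hτ⟩ := hW.1.2 χ hχs hχc
    have hprod := hτ.mul hθ (fun x ↦ hA (w x)) (fun x ↦ hB (p (w x)))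
    have hF : ContMDiff J 𝓘(ℝ, ℝ) 1 (fun z ↦ χ z * g (p z)) := hχs.mul (hg.comp hp)
    refine (((hW.2.2 _ _ hF hχc.mul_right hprod).and (hW.2.2 χ τ hχs hχc hτ)).and hθV).mono
      fun x hx v ↦ ?_
    obtain ⟨⟨h1, h2⟩, h3⟩ := hx
    have h4 := h1 v
    rw [differential_mul_comp (hχs.mdifferentiableAt one_ne_zero)
      (hg.mdifferentiableAt one_ne_zero) (hp.mdifferentiableAt one_ne_zero)] at h4
    change χ (w x) * θ x v + g (p (w x)) * τ x v = _ at h4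
    rw [h2 v, h3 v] at h4
    linarith
  refine (AlmostEverywhere.forall key).mono fun x hx v ↦ ?_
  -- Off one common null set the identity holds for every χ in the family, and one of them does not
  -- vanish at w x.
  obtain ⟨χ, hχ, hχx⟩ := (hsep (w x)).1
  exact mul_left_cancel₀ hχx (hx ⟨χ, hχ⟩ v)

end ChainRule

/-! ### Vertical and horizontal components of tangent vectors to T*M ⊗ TN -/

section SecondOrder

variable {m n : ℕ}
  {M : Type*} [TopologicalSpace M] [ChartedSpace (EuclideanSpace ℝ (Fin m)) M]
  [IsManifold (𝓡 m) 2 M]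
  {N : Type*} [TopologicalSpace N] [ChartedSpace (EuclideanSpace ℝ (Fin n)) N]
  [IsManifold (𝓡 n) 2 N]

variable (m n M N) in
theorem t2Space_totalHom [T2Space M] [T2Space N] : T2Space (TotalHom m n M N) :=
  t2Space_totalSpace (EuclideanSpace ℝ (Fin m) →L[ℝ] EuclideanSpace ℝ (Fin n))
    (HomTT (𝓡 m) M (𝓡 n) N)

variable (m n M N) in
theorem secondCountableTopology_totalHom [SecondCountableTopology M] [SecondCountableTopology N] :
    SecondCountableTopology (TotalHom m n M N) := by
  have := FiniteDimensional.proper ℝ (EuclideanSpace ℝ (Fin m) →L[ℝ] EuclideanSpace ℝ (Fin n))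
  exact secondCountableTopology_totalSpace
    (EuclideanSpace ℝ (Fin m) →L[ℝ] EuclideanSpace ℝ (Fin n)) (HomTT (𝓡 m) M (𝓡 n) N)

theorem contMDiff_proj_fst :
    ContMDiff (modelHom m n) (𝓡 m) 1 (fun e : TotalHom m n M N ↦ e.proj.1) :=
  contMDiff_fst.comp (contMDiff_proj (HomTT (𝓡 m) M (𝓡 n) N))

theorem contMDiff_proj_snd :
    ContMDiff (modelHom m n) (𝓡 n) 1 (fun e : TotalHom m n M N ↦ e.proj.2) :=
  contMDiff_snd.comp (contMDiff_proj (HomTT (𝓡 m) M (𝓡 n) N))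

/-- The differential of the projection `T*M ⊗ TN → M × N`. -/
def projDifferential (e : TotalHom m n M N) (ξ : TangentSpace (modelHom m n) e) :
    EuclideanSpace ℝ (Fin m) × EuclideanSpace ℝ (Fin n) :=
  mfderiv (modelHom m n) ((𝓡 m).prod (𝓡 n)) (TotalSpace.proj : TotalHom m n M N → M × N) e ξ

theorem mfderiv_proj_fst (e : TotalHom m n M N) (ξ : TangentSpace (modelHom m n) e) :
    mfderiv (modelHom m n) (𝓡 m) (fun e : TotalHom m n M N ↦ e.proj.1) e ξ =
      (projDifferential e ξ).1 := by
  have h := mfderiv_comp (I' := (𝓡 m).prod (𝓡 n)) e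
    (mdifferentiableAt_fst (I := 𝓡 m) (I' := 𝓡 n) (x := e.proj))
    (mdifferentiable_proj (IB := (𝓡 m).prod (𝓡 n)) (E := HomTT (𝓡 m) M (𝓡 n) N) e)
  rw [mfderiv_fst] at h
  exact congrArg (fun L : ((EuclideanSpace ℝ (Fin m) × EuclideanSpace ℝ (Fin n)) ×
    (EuclideanSpace ℝ (Fin m) →L[ℝ] EuclideanSpace ℝ (Fin n))) →L[ℝ]
      EuclideanSpace ℝ (Fin m) ↦ L ξ) h

theorem mfderiv_proj_snd (e : TotalHom m n M N) (ξ : TangentSpace (modelHom m n) e) :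
    mfderiv (modelHom m n) (𝓡 n) (fun e : TotalHom m n M N ↦ e.proj.2) e ξ =
      (projDifferential e ξ).2 := by
  have h := mfderiv_comp (I' := (𝓡 m).prod (𝓡 n)) e
    (mdifferentiableAt_snd (I := 𝓡 m) (I' := 𝓡 n) (x := e.proj))
    (mdifferentiable_proj (IB := (𝓡 m).prod (𝓡 n)) (E := HomTT (𝓡 m) M (𝓡 n) N) e)
  rw [mfderiv_snd] at h
  exact congrArg (fun L : ((EuclideanSpace ℝ (Fin m) × EuclideanSpace ℝ (Fin n)) ×
    (EuclideanSpace ℝ (Fin m) →L[ℝ] EuclideanSpace ℝ (Fin n))) →L[ℝ]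
      EuclideanSpace ℝ (Fin n) ↦ L ξ) h

variable {K : ConnectionHom m n M N} {u : M → N}
  {U : ∀ x : M, TangentSpace (𝓡 m) x →L[ℝ] TangentSpace (𝓡 n) (u x)}

theorem projDifferential_vertTerm_add_horTerm
    (D : ∀ x : M, TangentSpace (𝓡 m) x →L[ℝ] TangentSpace (𝓡 m) x →L[ℝ] TangentSpace (𝓡 n) (u x))
    (x : M) (v : TangentSpace (𝓡 m) x) :
    projDifferential (toHom (𝓡 n) u U x) (vertTerm u U D x v + horTerm K u U x v) =
      (v, U x v) := by
  have h1 := mfderiv_proj_vertLift (IB := (𝓡 m).prod (𝓡 n)) (toHom (𝓡 n) u U x) (D x v)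
  have h2 := K.mfderiv_proj_horLift (toHom (𝓡 n) u U x)
    ((v, U x v) : TangentSpace (𝓡 m) x × TangentSpace (𝓡 n) (u x))
  have h3 := map_add (mfderiv (modelHom m n) ((𝓡 m).prod (𝓡 n))
    (TotalSpace.proj : TotalHom m n M N → M × N) (toHom (𝓡 n) u U x))
    (vertTerm u U D x v) (horTerm K u U x v)
  refine h3.trans ?_
  refine (congrArg₂ (fun a b : EuclideanSpace ℝ (Fin m) × EuclideanSpace ℝ (Fin n) ↦ a + b)
    h1 h2).trans ?_
  exact zero_add _

theorem toFun_vertTerm_add_horTerm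
    (D : ∀ x : M, TangentSpace (𝓡 m) x →L[ℝ] TangentSpace (𝓡 m) x →L[ℝ] TangentSpace (𝓡 n) (u x))
    (x : M) (v : TangentSpace (𝓡 m) x) :
    K.toFun (toHom (𝓡 n) u U x) (vertTerm u U D x v + horTerm K u U x v) = D x v := by
  have h1 := K.map_vertLift (toHom (𝓡 n) u U x) (D x v)
  have h2 := K.toFun_horLift (toHom (𝓡 n) u U x)
    ((v, U x v) : TangentSpace (𝓡 m) x × TangentSpace (𝓡 n) (u x))
  refine (map_add (K.toFun (toHom (𝓡 n) u U x)) _ _).trans ?_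
  refine (congrArg₂ (fun a b : EuclideanSpace ℝ (Fin m) →L[ℝ] EuclideanSpace ℝ (Fin n) ↦ a + b)
    h1 h2).trans ?_
  exact add_zero _

/-- A tangent vector to `T*M ⊗ TN` is determined by its projection on `M × N` and by its image
under the connection. -/
theorem eq_vertTerm_add_horTerm
    (D : ∀ x : M, TangentSpace (𝓡 m) x →L[ℝ] TangentSpace (𝓡 m) x →L[ℝ] TangentSpace (𝓡 n) (u x))
    (x : M) (v : TangentSpace (𝓡 m) x) {ξ : TangentSpace (modelHom m n) (toHom (𝓡 n) u U x)}
    (h : projDifferential (toHom (𝓡 n) u U x) ξ = (v, U x v))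
    (h' : K.toFun (toHom (𝓡 n) u U x) ξ = D x v) :
    ξ = vertTerm u U D x v + horTerm K u U x v :=
  K.ext_splitting (h.trans (projDifferential_vertTerm_add_horTerm D x v).symm)
    (h'.trans (toFun_vertTerm_add_horTerm D x v).symm)

end SecondOrder

/-! ### Measurability of bundle morphisms tested on local frames -/

section MeasurabilityCriteria

variable {m : ℕ} {M : Type*} [TopologicalSpace M] [ChartedSpace (EuclideanSpace ℝ (Fin m)) M]
  [IsManifold (𝓡 m) 1 M]
  {E' : Type*} [NormedAddCommGroup E'] [NormedSpace ℝ E']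
  {H' : Type*} [TopologicalSpace H'] {J : ModelWithCorners ℝ E' H'}
  {P : Type*} [TopologicalSpace P] [ChartedSpace H' P] [IsManifold J 1 P]
  {E'' : Type*} [NormedAddCommGroup E''] [NormedSpace ℝ E'']
  {H'' : Type*} [TopologicalSpace H''] {JQ : ModelWithCorners ℝ E'' H''}
  {Q : Type*} [TopologicalSpace Q] [ChartedSpace H'' Q] [IsManifold JQ 1 Q]

/-- A tangent vector field along a map is measurable if its images by an injective family of
continuous bundle maps are. -/
theorem measurable_tangentBundle_mk {α : Type*} [MeasurableSpace α] {p : P → M}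
    {q : P → Q} (hp : ContMDiff J (𝓡 m) 1 p) (hq : ContMDiff J JQ 1 q)
    {Y : Type*} [TopologicalSpace Y] [T2Space Y] [SecondCountableTopology Y] [MeasurableSpace Y]
    [BorelSpace Y] {k : TangentBundle J P → Y} (hk : Continuous k)
    (hinj : ∀ (e : P) (ξ ξ' : TangentSpace J e),
      mfderiv J (𝓡 m) p e ξ = mfderiv J (𝓡 m) p e ξ' → mfderiv J JQ q e ξ = mfderiv J JQ q e ξ' →
      k ⟨e, ξ⟩ = k ⟨e, ξ'⟩ → ξ = ξ')
    [T2Space M] [SecondCountableTopology M] [T2Space P] [SecondCountableTopology P]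
    [T2Space Q] [SecondCountableTopology Q] [FiniteDimensional ℝ E'] [FiniteDimensional ℝ E'']
    [MeasurableSpace P] [BorelSpace P]
    [MeasurableSpace (TangentBundle (𝓡 m) M)] [BorelSpace (TangentBundle (𝓡 m) M)]
    [MeasurableSpace (TangentBundle JQ Q)] [BorelSpace (TangentBundle JQ Q)]
    [MeasurableSpace (TangentBundle J P)] [BorelSpace (TangentBundle J P)]
    {w : α → P} (hw : Measurable w) {ξ : ∀ a, TangentSpace J (w a)}
    (h1 : Measurable fun a ↦ (⟨p (w a), mfderiv J (𝓡 m) p (w a) (ξ a)⟩ : TangentBundle (𝓡 m) M))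
    (h2 : Measurable fun a ↦ (⟨q (w a), mfderiv J JQ q (w a) (ξ a)⟩ : TangentBundle JQ Q))
    (h3 : Measurable fun a ↦ k ⟨w a, ξ a⟩) :
    Measurable fun a ↦ (⟨w a, ξ a⟩ : TangentBundle J P) := by
  have := FiniteDimensional.proper ℝ E'
  have := FiniteDimensional.proper ℝ E''
  have := t2Space_totalSpace (EuclideanSpace ℝ (Fin m)) (TangentSpace (𝓡 m) : M → Type _)
  have := t2Space_totalSpace E'' (TangentSpace JQ : Q → Type _)
  have := secondCountableTopology_totalSpace (EuclideanSpace ℝ (Fin m))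
    (TangentSpace (𝓡 m) : M → Type _)
  have := secondCountableTopology_totalSpace E'' (TangentSpace JQ : Q → Type _)
  have := secondCountableTopology_totalSpace E' (TangentSpace J : P → Type _)
  have := J.tangent.locallyCompactSpace
  have : LocallyCompactSpace (TangentBundle J P) :=
    ChartedSpace.locallyCompactSpace (ModelProd H' E') _
  -- Recording the base point as well reduces injectivity of the map to the fibrewise hypothesis
  -- `hinj`.
  let Ψ : TangentBundle J P → (P × TangentBundle (𝓡 m) M) × (TangentBundle JQ Q × Y) :=
    fun ξ ↦ ((ξ.proj, tangentMap J (𝓡 m) p ξ), (tangentMap J JQ q ξ, k ξ))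
  have hΨ : Continuous Ψ :=
    ((FiberBundle.continuous_proj E' (TangentSpace J : P → Type _)).prodMk
      (hp.continuous_tangentMap le_rfl)).prodMk
      ((hq.continuous_tangentMap le_rfl).prodMk hk)
  refine measurable_of_continuous_injective_comp hΨ ?_ ((hw.prodMk h1).prodMk (h2.prodMk h3))
  rintro ⟨e, ξ⟩ ⟨e', ξ'⟩ h
  obtain rfl : e = e' := congrArg (fun z ↦ z.1.1) h
  exact congrArg (TotalSpace.mk e) (hinj e ξ ξ'
    (TotalSpace.mk_injective _ (congrArg (fun z ↦ z.1.2) h))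
    (TotalSpace.mk_injective _ (congrArg (fun z ↦ z.2.1) h))
    (congrArg (fun z ↦ z.2.2) h))

/-- A family of linear maps `W x : T_x M → T_{w x} P` is measurable. -/
def MeasurableBundleMap (w : M → P)
    (W : ∀ x : M, TangentSpace (𝓡 m) x →L[ℝ] TangentSpace J (w x)) : Prop :=
  MeasurableMap m (toHom J w W)

theorem measurable_localFrame_lebesgue [MeasurableSpace (TangentBundle (𝓡 m) M)]
    [BorelSpace (TangentBundle (𝓡 m) M)] (x₀ : M) (v : EuclideanSpace ℝ (Fin m)) :
    letI := lebesgueMeasurableSpace m M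
    Measurable fun x : (trivializationAt (EuclideanSpace ℝ (Fin m))
        (TangentSpace (𝓡 m) : M → Type _) x₀).baseSet ↦
      (⟨x, localFrame (𝓡 m) x₀ v x⟩ : TangentBundle (𝓡 m) M) := by
  -- Stated for an abstract source space, so that the Borel σ-algebra on M does not collide with the
  -- Lebesgue one.
  have key : ∀ (α : Type _) (_ : MeasurableSpace α) (p : α → M), @Measurable _ _ _ (borel M) p →
      (∀ a, p a ∈ (trivializationAt (EuclideanSpace ℝ (Fin m))
        (TangentSpace (𝓡 m) : M → Type _) x₀).baseSet) →
      Measurable fun a ↦ (⟨p a, localFrame (𝓡 m) x₀ v (p a)⟩ : TangentBundle (𝓡 m) M) := by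
    intro α _ p hp hpx
    borelize M
    exact measurable_localFrame hp hpx v
  let _ := lebesgueMeasurableSpace m M
  exact key _ _ _ ((measurable_id_lebesgue m M).comp measurable_subtype_coe) fun x ↦ x.2

theorem MeasurableBundleMap.localFrame_apply [MeasurableSpace (TangentBundle J P)]
    [BorelSpace (TangentBundle J P)] {w : M → P}
    {W : ∀ x : M, TangentSpace (𝓡 m) x →L[ℝ] TangentSpace J (w x)}
    (hW : MeasurableBundleMap w W) (x₀ : M) (v : EuclideanSpace ℝ (Fin m)) :
    letI := lebesgueMeasurableSpace m M
    Measurable fun x : (trivializationAt (EuclideanSpace ℝ (Fin m))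
        (TangentSpace (𝓡 m) : M → Type _) x₀).baseSet ↦
      (⟨w x, W x (localFrame (𝓡 m) x₀ v x)⟩ : TangentBundle J P) := by
  let _ := lebesgueMeasurableSpace m M
  borelize (TotalSpace (EuclideanSpace ℝ (Fin m) →L[ℝ] E') (HomTT (𝓡 m) M J P))
  rw [MeasurableBundleMap, measurableMap_iff] at hW
  exact measurable_homTT_apply (p := Subtype.val) (W := fun x ↦ W x.1)
    (hW.comp measurable_subtype_coe) (fun x ↦ x.2) v

theorem measurableBundleMap_of_localFrame [MeasurableSpace (TangentBundle J P)]
    [BorelSpace (TangentBundle J P)] [SecondCountableTopology M] [SecondCountableTopology P]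
    [FiniteDimensional ℝ E'] {w : M → P} (hw : MeasurableMap m w)
    {W : ∀ x : M, TangentSpace (𝓡 m) x →L[ℝ] TangentSpace J (w x)}
    (hW : letI := lebesgueMeasurableSpace m M
      ∀ (x₀ : M) (v : EuclideanSpace ℝ (Fin m)),
        Measurable fun x : (trivializationAt (EuclideanSpace ℝ (Fin m))
          (TangentSpace (𝓡 m) : M → Type _) x₀).baseSet ↦
          (⟨w x, W x (localFrame (𝓡 m) x₀ v x)⟩ : TangentBundle J P)) :
    MeasurableBundleMap w W := by
  have key : ∀ (α : Type _) (_ : MeasurableSpace α) (p : α → M) (c : α → P)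
      (T : ∀ a, TangentSpace (𝓡 m) (p a) →L[ℝ] TangentSpace J (c a)),
      @Measurable _ _ _ (borel M) p → @Measurable _ _ _ (borel P) c →
      (∀ (x₀ : M) (v : EuclideanSpace ℝ (Fin m)), Measurable
        fun a : p ⁻¹' (trivializationAt (EuclideanSpace ℝ (Fin m))
          (TangentSpace (𝓡 m) : M → Type _) x₀).baseSet ↦
          (⟨c a, T a (localFrame (𝓡 m) x₀ v (p a))⟩ : TangentBundle J P)) →
      @Measurable _ _ _ (borel _) fun a ↦ (⟨(p a, c a), T a⟩ :
        TotalSpace (EuclideanSpace ℝ (Fin m) →L[ℝ] E') (HomTT (𝓡 m) M J P)) := by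
    intro α _ p c T hp hc hT
    borelize (TotalSpace (EuclideanSpace ℝ (Fin m) →L[ℝ] E') (HomTT (𝓡 m) M J P)) P M
    exact measurable_homTT_of_apply hp hc hT
  borelize (TotalSpace (EuclideanSpace ℝ (Fin m) →L[ℝ] E') (HomTT (𝓡 m) M J P)) P
  rw [measurableMap_iff] at hw
  rw [MeasurableBundleMap, measurableMap_iff]
  exact key M (lebesgueMeasurableSpace m M) id w W (measurable_id_lebesgue m M) hw hW

end MeasurabilityCriteria

/-! ### Measurability of second-order objects -/

section SecondOrderMeasurability

variable {m n : ℕ}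
  {M : Type*} [TopologicalSpace M] [ChartedSpace (EuclideanSpace ℝ (Fin m)) M]
  [IsManifold (𝓡 m) 2 M]
  {N : Type*} [TopologicalSpace N] [ChartedSpace (EuclideanSpace ℝ (Fin n)) N]
  [IsManifold (𝓡 n) 2 N]
  {u : M → N} {U : ∀ x : M, TangentSpace (𝓡 m) x →L[ℝ] TangentSpace (𝓡 n) (u x)}

theorem localFrame_apply_homTTT [MeasurableSpace (TotalHom m n M N)] [BorelSpace (TotalHom m n M N)]
    {D : ∀ x : M, TangentSpace (𝓡 m) x →L[ℝ] TangentSpace (𝓡 m) x →L[ℝ] TangentSpace (𝓡 n) (u x)}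
    (hD : MeasurableMap m (fun x : M ↦ (⟨(x, u x), D x⟩ : TotalSpace
      (EuclideanSpace ℝ (Fin m) →L[ℝ] EuclideanSpace ℝ (Fin m) →L[ℝ] EuclideanSpace ℝ (Fin n))
      (HomTTT (𝓡 m) M (𝓡 n) N)))) (x₀ : M) (v : EuclideanSpace ℝ (Fin m)) :
    letI := lebesgueMeasurableSpace m M
    Measurable fun x : (trivializationAt (EuclideanSpace ℝ (Fin m))
        (TangentSpace (𝓡 m) : M → Type _) x₀).baseSet ↦
      (⟨(x, u x), D x (localFrame (𝓡 m) x₀ v x)⟩ : TotalHom m n M N) := by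
  let _ := lebesgueMeasurableSpace m M
  borelize (TotalSpace
    (EuclideanSpace ℝ (Fin m) →L[ℝ] EuclideanSpace ℝ (Fin m) →L[ℝ] EuclideanSpace ℝ (Fin n))
    (HomTTT (𝓡 m) M (𝓡 n) N))
  rw [measurableMap_iff] at hD
  have h1 := measurable_hom_apply (E₁ := PullTM (𝓡 m) M N) (E₂ := HomTT (𝓡 m) M (𝓡 n) N)
    (c := fun x : (trivializationAt (EuclideanSpace ℝ (Fin m))
        (TangentSpace (𝓡 m) : M → Type _) x₀).baseSet ↦ (x.1, u x)) (T := fun x ↦ D x)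
    (hD.comp measurable_subtype_coe)
    (trivializationAt (EuclideanSpace ℝ (Fin m)) (PullTM (𝓡 m) M N) (x₀, u x₀))
    (fun x ↦ x.2) v
  refine (congrArg Measurable (funext fun x ↦ ?_)).mpr h1
  exact congrArg (fun ξ : TangentSpace (𝓡 m) x.1 ↦ (⟨(x, u x), D x ξ⟩ : TotalHom m n M N))
    (trivializationAt_pullTM_symm (b₀ := (x₀, u x₀)) (b := (x.1, u x)) x.2 v).symm

variable [SecondCountableTopology M] [SecondCountableTopology N]

/-- The bundle T*M ⊗ T*M ⊗ TN is again a bundle of homomorphisms out of TM, with values in T*M ⊗ TN,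
so evaluations on frames suffice. -/
theorem measurableMap_homTTT_of_localFrame
    [MeasurableSpace (TotalHom m n M N)] [BorelSpace (TotalHom m n M N)]
    (hu : MeasurableMap m u)
    {D : ∀ x : M, TangentSpace (𝓡 m) x →L[ℝ] TangentSpace (𝓡 m) x →L[ℝ] TangentSpace (𝓡 n) (u x)}
    (hD : letI := lebesgueMeasurableSpace m M
      ∀ (x₀ : M) (v : EuclideanSpace ℝ (Fin m)),
        Measurable fun x : (trivializationAt (EuclideanSpace ℝ (Fin m))
          (TangentSpace (𝓡 m) : M → Type _) x₀).baseSet ↦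
        (⟨(x, u x), D x (localFrame (𝓡 m) x₀ v x)⟩ : TotalHom m n M N)) :
    MeasurableMap m (fun x : M ↦ (⟨(x, u x), D x⟩ : TotalSpace
      (EuclideanSpace ℝ (Fin m) →L[ℝ] EuclideanSpace ℝ (Fin m) →L[ℝ] EuclideanSpace ℝ (Fin n))
      (HomTTT (𝓡 m) M (𝓡 n) N))) := by
  have hc : MeasurableMap m fun x ↦ (x, u x) := by
    borelize M N
    exact measurableMap_iff.2 ((measurable_id_lebesgue m M).prodMk (measurableMap_iff.1 hu))
  borelize (M × N) (TotalSpace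
    (EuclideanSpace ℝ (Fin m) →L[ℝ] EuclideanSpace ℝ (Fin m) →L[ℝ] EuclideanSpace ℝ (Fin n))
    (HomTTT (𝓡 m) M (𝓡 n) N))
  rw [measurableMap_iff] at hc ⊢
  let _ := lebesgueMeasurableSpace m M
  refine measurable_hom_of_apply (E₁ := PullTM (𝓡 m) M N) (E₂ := HomTT (𝓡 m) M (𝓡 n) N)
    (c := fun x : M ↦ (x, u x)) (T := fun x ↦ D x) hc fun b₀ v ↦ ?_
  refine (congrArg Measurable (funext fun x ↦ ?_)).mpr (hD b₀.1 v)
  exact congrArg (fun ξ : TangentSpace (𝓡 m) x.1 ↦ (⟨(x, u x), D x ξ⟩ : TotalHom m n M N))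
    (trivializationAt_pullTM_symm (b₀ := b₀) (b := (x.1, u x)) x.2 v)

theorem measurableMap_toFun_comp (K : ConnectionHom m n M N) (hu : MeasurableMap m u)
    {W : ∀ x : M, TangentSpace (𝓡 m) x →L[ℝ]
      TangentSpace (modelHom m n) (toHom (𝓡 n) u U x)}
    (hW : MeasurableBundleMap (J := modelHom m n) (toHom (𝓡 n) u U) W) :
    MeasurableMap m (fun x : M ↦ (⟨(x, u x), (K.toFun (toHom (𝓡 n) u U x)).comp (W x)⟩ : TotalSpace
      (EuclideanSpace ℝ (Fin m) →L[ℝ] EuclideanSpace ℝ (Fin m) →L[ℝ] EuclideanSpace ℝ (Fin n))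
      (HomTTT (𝓡 m) M (𝓡 n) N))) := by
  let _ := lebesgueMeasurableSpace m M
  borelize (TangentBundle (modelHom m n) (TotalHom m n M N)) (TotalHom m n M N)
  refine measurableMap_homTTT_of_localFrame hu fun x₀ v ↦ ?_
  exact K.continuous_toFun.measurable.comp (hW.localFrame_apply x₀ v)

/-- The two projections and K are jointly injective on each tangent space by the splitting, which is
the hypothesis of `measurable_tangentBundle_mk`. -/
theorem measurable_tangentBundle_totalHom_mk [T2Space M] [T2Space N] (K : ConnectionHom m n M N)
    [MeasurableSpace (TotalHom m n M N)] [BorelSpace (TotalHom m n M N)]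
    [MeasurableSpace (TangentBundle (modelHom m n) (TotalHom m n M N))]
    [BorelSpace (TangentBundle (modelHom m n) (TotalHom m n M N))]
    [MeasurableSpace (TangentBundle (𝓡 m) M)] [BorelSpace (TangentBundle (𝓡 m) M)]
    [MeasurableSpace (TangentBundle (𝓡 n) N)] [BorelSpace (TangentBundle (𝓡 n) N)]
    {α : Type*} [MeasurableSpace α] {w : α → TotalHom m n M N} (hw : Measurable w)
    {ξ : ∀ a, TangentSpace (modelHom m n) (w a)}
    (h1 : Measurable fun a ↦ (⟨(w a).proj.1, mfderiv (modelHom m n) (𝓡 m)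
      (fun e : TotalHom m n M N ↦ e.proj.1) (w a) (ξ a)⟩ : TangentBundle (𝓡 m) M))
    (h2 : Measurable fun a ↦ (⟨(w a).proj.2, mfderiv (modelHom m n) (𝓡 n)
      (fun e : TotalHom m n M N ↦ e.proj.2) (w a) (ξ a)⟩ : TangentBundle (𝓡 n) N))
    (h3 : Measurable fun a ↦ (⟨(w a).proj, K.toFun (w a) (ξ a)⟩ : TotalHom m n M N)) :
    Measurable fun a ↦
      (⟨w a, ξ a⟩ : TangentBundle (modelHom m n) (TotalHom m n M N)) := by
  have := t2Space_totalHom m n M N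
  have := secondCountableTopology_totalHom m n M N
  have hinj : ∀ (e : TotalHom m n M N) (ξ ξ' : TangentSpace (modelHom m n) e),
      mfderiv (modelHom m n) (𝓡 m) (fun e : TotalHom m n M N ↦ e.proj.1) e ξ =
        mfderiv (modelHom m n) (𝓡 m) (fun e : TotalHom m n M N ↦ e.proj.1) e ξ' →
      mfderiv (modelHom m n) (𝓡 n) (fun e : TotalHom m n M N ↦ e.proj.2) e ξ =
        mfderiv (modelHom m n) (𝓡 n) (fun e : TotalHom m n M N ↦ e.proj.2) e ξ' →
      (⟨e.proj, K.toFun e ξ⟩ : TotalHom m n M N) = ⟨e.proj, K.toFun e ξ'⟩ → ξ = ξ' := by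
    intro e ξ ξ' h1 h2 h3
    rw [mfderiv_proj_fst, mfderiv_proj_fst] at h1
    rw [mfderiv_proj_snd, mfderiv_proj_snd] at h2
    exact K.ext_splitting (Prod.ext h1 h2) (TotalSpace.mk_injective _ h3)
  exact measurable_tangentBundle_mk contMDiff_proj_fst contMDiff_proj_snd
    (k := fun ξ : TangentBundle (modelHom m n) (TotalHom m n M N) ↦
      (⟨ξ.proj.proj, K.toFun ξ.proj ξ.2⟩ : TotalHom m n M N)) K.continuous_toFun hinj hw h1 h2 h3

/-- On a local frame, the three components of W are the frame vector, its image under U and its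
image under D, all of them measurable. -/
theorem measurableBundleMap_of_splitting [T2Space M] [T2Space N] (K : ConnectionHom m n M N)
    (hU : MeasurableMap m (toHom (𝓡 n) u U))
    {D : ∀ x : M, TangentSpace (𝓡 m) x →L[ℝ] TangentSpace (𝓡 m) x →L[ℝ] TangentSpace (𝓡 n) (u x)}
    (hD : MeasurableMap m (fun x : M ↦ (⟨(x, u x), D x⟩ : TotalSpace
      (EuclideanSpace ℝ (Fin m) →L[ℝ] EuclideanSpace ℝ (Fin m) →L[ℝ] EuclideanSpace ℝ (Fin n))
      (HomTTT (𝓡 m) M (𝓡 n) N))))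
    {W : ∀ x : M, TangentSpace (𝓡 m) x →L[ℝ]
      TangentSpace (modelHom m n) (toHom (𝓡 n) u U x)}
    (hW : ∀ x v, projDifferential (toHom (𝓡 n) u U x) (W x v) = (v, U x v))
    (hWD : ∀ x v, K.toFun (toHom (𝓡 n) u U x) (W x v) = D x v) :
    MeasurableBundleMap (J := modelHom m n) (toHom (𝓡 n) u U) W := by
  let _ := lebesgueMeasurableSpace m M
  have := secondCountableTopology_totalHom m n M N
  borelize (TangentBundle (modelHom m n) (TotalHom m n M N)) (TotalHom m n M N)
    (TangentBundle (𝓡 m) M) (TangentBundle (𝓡 n) N)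
  refine measurableBundleMap_of_localFrame hU fun x₀ v ↦ ?_
  have h1 : Measurable fun x : (trivializationAt (EuclideanSpace ℝ (Fin m))
      (TangentSpace (𝓡 m) : M → Type _) x₀).baseSet ↦ (⟨x, mfderiv (modelHom m n) (𝓡 m)
        (fun e : TotalHom m n M N ↦ e.proj.1) (toHom (𝓡 n) u U x)
          (W x (localFrame (𝓡 m) x₀ v x))⟩ : TangentBundle (𝓡 m) M) := by
    refine (congrArg Measurable (funext fun x ↦ ?_)).mpr (measurable_localFrame_lebesgue x₀ v)
    exact congrArg (TotalSpace.mk x.1) ((mfderiv_proj_fst (toHom (𝓡 n) u U x) _).trans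
      (congrArg Prod.fst (hW x _)))
  have h2 : Measurable fun x : (trivializationAt (EuclideanSpace ℝ (Fin m))
      (TangentSpace (𝓡 m) : M → Type _) x₀).baseSet ↦ (⟨u x, mfderiv (modelHom m n) (𝓡 n)
        (fun e : TotalHom m n M N ↦ e.proj.2) (toHom (𝓡 n) u U x)
          (W x (localFrame (𝓡 m) x₀ v x))⟩ : TangentBundle (𝓡 n) N) := by
    refine (congrArg Measurable (funext fun x ↦ ?_)).mpr
      (MeasurableBundleMap.localFrame_apply (J := 𝓡 n) hU x₀ v)
    exact congrArg (TotalSpace.mk (u x.1)) ((mfderiv_proj_snd (toHom (𝓡 n) u U x) _).trans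
      (congrArg Prod.snd (hW x _)))
  have h3 : Measurable fun x : (trivializationAt (EuclideanSpace ℝ (Fin m))
      (TangentSpace (𝓡 m) : M → Type _) x₀).baseSet ↦
        (⟨(x, u x), K.toFun (toHom (𝓡 n) u U x)
          (W x (localFrame (𝓡 m) x₀ v x))⟩ : TotalHom m n M N) := by
    refine (congrArg Measurable (funext fun x ↦ ?_)).mpr (localFrame_apply_homTTT hD x₀ v)
    exact congrArg (TotalSpace.mk (x.1, u x.1)) (hWD x _)
  exact measurable_tangentBundle_totalHom_mk K
    ((measurableMap_iff.1 hU).comp measurable_subtype_coe) h1 h2 h3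

end SecondOrderMeasurability

/-! ### Passing between the weak derivative and the covariant derivative -/

section CovariantDerivative

variable {m n : ℕ}
  {M : Type*} [TopologicalSpace M] [T2Space M] [SecondCountableTopology M]
  [ChartedSpace (EuclideanSpace ℝ (Fin m)) M] [IsManifold (𝓡 m) 2 M]
  {N : Type*} [TopologicalSpace N] [T2Space N] [SecondCountableTopology N]
  [ChartedSpace (EuclideanSpace ℝ (Fin n)) N] [IsManifold (𝓡 n) 2 N]
  {K : ConnectionHom m n M N} {u : M → N}
  {U : ∀ x : M, TangentSpace (𝓡 m) x →L[ℝ] TangentSpace (𝓡 n) (u x)}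

/-- The horizontal terms are the same for both, so the vertical lifts agree almost everywhere, and K
∘ Vert = id recovers the derivatives. -/
theorem IsColocalWeakCovariantDerivative.ae_eq
    {D₁ D₂ : ∀ x : M, TangentSpace (𝓡 m) x →L[ℝ] TangentSpace (𝓡 m) x →L[ℝ]
      TangentSpace (𝓡 n) (u x)}
    (h₁ : IsColocalWeakCovariantDerivative K u U D₁)
    (h₂ : IsColocalWeakCovariantDerivative K u U D₂) :
    AlmostEverywhere m fun x : M ↦ D₁ x = D₂ x := by
  have := t2Space_totalHom m n M N
  have := secondCountableTopology_totalHom m n M N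
  refine (AlmostEverywhere.of_forall_differential_eq (J := modelHom m n) (w := toHom (𝓡 n) u U)
    (ξ₁ := vertTerm u U D₁) (ξ₂ := vertTerm u U D₂) fun f hf hfc ↦ ?_).mono
      fun x hx ↦ ContinuousLinearMap.ext fun v ↦ ?_
  · obtain ⟨θ, hθ⟩ := h₁.1.2 f hf hfc
    refine ((h₁.2.2 f θ hf hfc hθ).and (h₂.2.2 f θ hf hfc hθ)).mono fun x hx v ↦ ?_
    rw [hx.1, hx.2]
  · have h3 := K.map_vertLift (toHom (𝓡 n) u U x) (D₁ x v)
    have h4 := K.map_vertLift (toHom (𝓡 n) u U x) (D₂ x v)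
    exact h3.symm.trans ((congrArg (K.toFun (toHom (𝓡 n) u U x)) (hx v)).trans h4)

theorem IsColocalWeakCovariantDerivative.ae_eq_vertTerm_add_horTerm
    {D : ∀ x : M, TangentSpace (𝓡 m) x →L[ℝ] TangentSpace (𝓡 m) x →L[ℝ]
      TangentSpace (𝓡 n) (u x)}
    {W : ∀ x : M, TangentSpace (𝓡 m) x →L[ℝ] TangentSpace (modelHom m n) (toHom (𝓡 n) u U x)}
    (hD : IsColocalWeakCovariantDerivative K u U D)
    (hW : IsColocalWeakDerivative (modelHom m n) (toHom (𝓡 n) u U) W) :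
    AlmostEverywhere m fun x : M ↦ ∀ v : TangentSpace (𝓡 m) x,
      W x v = vertTerm u U D x v + horTerm K u U x v := by
  have := t2Space_totalHom m n M N
  have := secondCountableTopology_totalHom m n M N
  refine AlmostEverywhere.of_forall_differential_eq (J := modelHom m n) (w := toHom (𝓡 n) u U)
    (ξ₁ := fun x v ↦ W x v) (ξ₂ := fun x v ↦ vertTerm u U D x v + horTerm K u U x v)
    fun f hf hfc ↦ ?_
  obtain ⟨θ, hθ⟩ := hD.1.2 f hf hfc
  refine ((hD.2.2 f θ hf hfc hθ).and (hW.2.2 f θ hf hfc hθ)).mono fun x hx v ↦ ?_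
  rw [differential_add, hx.1 v, ← hx.2 v, sub_add_cancel]

theorem IsColocalWeakCovariantDerivative.exists_isColocalWeakDerivative
    (hU : MeasurableMap m (toHom (𝓡 n) u U))
    {D : ∀ x : M, TangentSpace (𝓡 m) x →L[ℝ] TangentSpace (𝓡 m) x →L[ℝ]
      TangentSpace (𝓡 n) (u x)}
    (hD : IsColocalWeakCovariantDerivative K u U D) :
    ∃ W : ∀ x : M, TangentSpace (𝓡 m) x →L[ℝ] TangentSpace (modelHom m n) (toHom (𝓡 n) u U x),
      IsColocalWeakDerivative (modelHom m n) (toHom (𝓡 n) u U) W := by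
  -- Prescribing both components through the inverse of the splitting makes W linear in v by
  -- construction and gives its decomposition at every point, not only almost everywhere.
  let W : ∀ x : M, TangentSpace (𝓡 m) x →L[ℝ] TangentSpace (modelHom m n) (toHom (𝓡 n) u U x) :=
    fun x ↦ ((K.splitting (toHom (𝓡 n) u U x)).inverse).comp
      (((ContinuousLinearMap.id ℝ (TangentSpace (𝓡 m) x)).prod (U x)).prod (D x))
  have hW : ∀ x v, K.splitting (toHom (𝓡 n) u U x) (W x v) = ((v, U x v), D x v) := fun x v ↦
    K.splitting_inverse (toHom (𝓡 n) u U x) ((v, U x v), D x v)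
  have hW1 : ∀ x v, projDifferential (toHom (𝓡 n) u U x) (W x v) = (v, U x v) := fun x v ↦
    congrArg Prod.fst (hW x v)
  have hW2 : ∀ x v, K.toFun (toHom (𝓡 n) u U x) (W x v) = D x v := fun x v ↦
    congrArg Prod.snd (hW x v)
  refine ⟨W, hD.1, measurableBundleMap_of_splitting K hU hD.2.1 hW1 hW2,
    fun f θ hf hfc hθ ↦ (hD.2.2 f θ hf hfc hθ).mono fun x hx v ↦ ?_⟩
  rw [eq_vertTerm_add_horTerm D x v (hW1 x v) (hW2 x v), differential_add, hx v, sub_add_cancel]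

/-- The projections of Tu on M and N are the identity and u, with weak derivatives the identity and
U; the chain rule identifies them with the projections of W. -/
theorem ae_projDifferential_eq (hU : IsColocalWeakDerivative (𝓡 n) u U)
    {W : ∀ x : M, TangentSpace (𝓡 m) x →L[ℝ] TangentSpace (modelHom m n) (toHom (𝓡 n) u U x)}
    (hW : IsColocalWeakDerivative (modelHom m n) (toHom (𝓡 n) u U) W) :
    AlmostEverywhere m fun x : M ↦ ∀ v : TangentSpace (𝓡 m) x,
      projDifferential (toHom (𝓡 n) u U x) (W x v) = (v, U x v) := by
  have := t2Space_totalHom m n M N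
  have := secondCountableTopology_totalHom m n M N
  have h1 := hW.mfderiv_comp (JQ := 𝓡 m) contMDiff_proj_fst
    (V := fun x ↦ ContinuousLinearMap.id ℝ (TangentSpace (𝓡 m) x)) fun g hg _ ↦
      ⟨differentialCovector g, isWeakDerivative_differentialCovector hg, fun x₀ ↦
        Filter.Eventually.of_forall fun y v ↦ rfl⟩
  have h2 := hW.mfderiv_comp (JQ := 𝓡 n) contMDiff_proj_snd (V := U) fun g hg hgc ↦ by
    obtain ⟨θ, hθ⟩ := hU.1.2 g hg hgc
    exact ⟨θ, hθ, hU.2.2 g θ hg hgc hθ⟩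
  refine (h1.and h2).mono fun x hx v ↦ Prod.ext ?_ ?_
  · exact (mfderiv_proj_fst (toHom (𝓡 n) u U x) (W x v)).symm.trans (hx.1 v)
  · exact (mfderiv_proj_snd (toHom (𝓡 n) u U x) (W x v)).symm.trans (hx.2 v)

/-- Once the projection of W is known almost everywhere, W is the sum of the vertical lift of K ∘ W
and the horizontal term, and linearity of Tf gives the defining identity. -/
theorem IsColocalWeakDerivative.isColocalWeakCovariantDerivative (K : ConnectionHom m n M N)
    (hU : IsColocalWeakDerivative (𝓡 n) u U)
    {W : ∀ x : M, TangentSpace (𝓡 m) x →L[ℝ] TangentSpace (modelHom m n) (toHom (𝓡 n) u U x)}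
    (hW : IsColocalWeakDerivative (modelHom m n) (toHom (𝓡 n) u U) W) :
    IsColocalWeakCovariantDerivative K u U
      fun x ↦ (K.toFun (toHom (𝓡 n) u U x)).comp (W x) := by
  refine ⟨hW.1, measurableMap_toFun_comp K hU.1.1 hW.2.1, fun f θ hf hfc hθ ↦ ?_⟩
  refine ((hW.2.2 f θ hf hfc hθ).and (ae_projDifferential_eq hU hW)).mono fun x hx v ↦ ?_
  rw [hx.1 v, eq_sub_iff_add_eq, ← differential_add]
  congr 1
  exact (eq_vertTerm_add_horTerm _ x v (hx.2 v) rfl).symm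

end CovariantDerivative

end Colocal

end

/-! ### The proposition -/

theorem proposition3p2 {m n : ℕ}
    {M : Type*} [TopologicalSpace M] [T2Space M] [SecondCountableTopology M]
    [ChartedSpace (EuclideanSpace ℝ (Fin m)) M] [IsManifold (𝓡 m) 2 M]
    {N : Type*} [TopologicalSpace N] [T2Space N] [SecondCountableTopology N]
    [ChartedSpace (EuclideanSpace ℝ (Fin n)) N] [IsManifold (𝓡 n) 2 N]
    (K : Colocal.ConnectionHom m n M N)
    (u : M → N) (hu : Colocal.TwiceColocallyWeaklyDifferentiable m n u)
    (Tu : ∀ x : M, TangentSpace (𝓡 m) x →L[ℝ] TangentSpace (𝓡 n) (u x))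
    (hTu : Colocal.IsColocalWeakDerivative (𝓡 n) u Tu) :
    -- a colocal weak covariant derivative exists if and only if a colocal weak derivative exists
    ((∃ D : ∀ x : M, TangentSpace (𝓡 m) x →L[ℝ] TangentSpace (𝓡 m) x →L[ℝ]
        TangentSpace (𝓡 n) (u x),
        Colocal.IsColocalWeakCovariantDerivative K u Tu D) ↔
      ∃ TTu : ∀ x : M, TangentSpace (𝓡 m) x →L[ℝ]
        TangentSpace (Colocal.modelHom m n) (Colocal.toHom (𝓡 n) u Tu x),
        Colocal.IsColocalWeakDerivative (Colocal.modelHom m n)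
        (Colocal.toHom (𝓡 n) u Tu) TTu) ∧
    -- uniqueness of the colocal weak covariant derivative
    (∀ D₁ D₂ : ∀ x : M, TangentSpace (𝓡 m) x →L[ℝ] TangentSpace (𝓡 m) x →L[ℝ]
        TangentSpace (𝓡 n) (u x),
      Colocal.IsColocalWeakCovariantDerivative K u Tu D₁ →
      Colocal.IsColocalWeakCovariantDerivative K u Tu D₂ →
      Colocal.AlmostEverywhere m fun x : M ↦ D₁ x = D₂ x) ∧
    -- uniqueness of the colocal weak derivative
    (∀ TTu₁ TTu₂ : ∀ x : M, TangentSpace (𝓡 m) x →L[ℝ]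
        TangentSpace (Colocal.modelHom m n) (Colocal.toHom (𝓡 n) u Tu x),
      Colocal.IsColocalWeakDerivative (Colocal.modelHom m n) (Colocal.toHom (𝓡 n) u Tu) TTu₁ →
      Colocal.IsColocalWeakDerivative (Colocal.modelHom m n) (Colocal.toHom (𝓡 n) u Tu) TTu₂ →
      Colocal.AlmostEverywhere m fun x : M ↦ TTu₁ x = TTu₂ x) ∧
    -- the relations between them
    (∀ (D : ∀ x : M, TangentSpace (𝓡 m) x →L[ℝ] TangentSpace (𝓡 m) x →L[ℝ]
        TangentSpace (𝓡 n) (u x))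
      (TTu : ∀ x : M, TangentSpace (𝓡 m) x →L[ℝ]
        TangentSpace (Colocal.modelHom m n) (Colocal.toHom (𝓡 n) u Tu x)),
      Colocal.IsColocalWeakCovariantDerivative K u Tu D →
      Colocal.IsColocalWeakDerivative (Colocal.modelHom m n) (Colocal.toHom (𝓡 n) u Tu) TTu →
      Colocal.AlmostEverywhere m fun x : M ↦ ∀ v : TangentSpace (𝓡 m) x,
        TTu x v = Colocal.vertTerm u Tu D x v + Colocal.horTerm K u Tu x v ∧
        D x v = K.toFun (Colocal.toHom (𝓡 n) u Tu x) (TTu x v)) := by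
  refine ⟨⟨?_, ?_⟩, ?_, ?_, ?_⟩
  · rintro ⟨D, hD⟩
    exact hD.exists_isColocalWeakDerivative hTu.2.1
  · rintro ⟨W, hW⟩
    exact ⟨_, hTu.isColocalWeakCovariantDerivative K hW⟩
  · exact fun D₁ D₂ h₁ h₂ ↦ h₁.ae_eq h₂
  · have := Colocal.t2Space_totalHom m n M N
    have := Colocal.secondCountableTopology_totalHom m n M N
    exact fun W₁ W₂ h₁ h₂ ↦ h₁.ae_eq h₂
  · refine fun D W hD hW ↦ (hD.ae_eq_vertTerm_add_horTerm hW).mono fun x hx v ↦ ⟨hx v, ?_⟩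
    rw [hx v]
    exact (Colocal.toFun_vertTerm_add_horTerm D x v).symm
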